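/- \textbf{Setting.} Consider a zero-sum matrix game with finite nonempty action sets $\mathcal{A}^1,\mathcal{A}^2$, payoff matrices $\mathcal{R}^1\in\mathbb{R}^{|\mathcal{A}^1|\times|\mathcal{A}^2|}$ and $\mathcal{R}^2=-(\mathcal{R}^1)^\top$ with $\max_{a^1,a^2}|\mathcal{R}^1(a^1,a^2)|\le 1$, and let $A_{\max}=\max(|\mathcal{A}^1|,|\mathcal{A}^2|)$. For policies $\pi^i$ in the probability simplex $\Delta(\mathcal{A}^i)$ the Nash gap is $\mathrm{NG}(\pi^1,\pi^2)=\sum_{i=1,2}\max_{\hat\pi^i\in\Delta(\mathcal{A}^i)}(\hat\pi^i-\pi^i)^\top\mathcal{R}^i\pi^{-i}$, where $-i$ denotes the opponent of $i$. For a temperature $\tau>0$ let $[\sigma_\tau(q)](a)=\exp(q(a)/\tau)/\sum_{\tilde a}\exp(q(\tilde a)/\tau)$. In the Doubly Smoothed Best-Response (DSBR) dynamics with stepsizes $\alpha_k,\beta_k$, each player $i\in\{1,2\}$ starts from $q^i_0=0$ and the uniform policy $\pi^i_0$, and for $k=0,1,\dots,K-1$: (i) sets $\pi^i_{k+1}=\pi^i_k+\beta_k(\sigma_\tau(q^i_k)-\pi^i_k)$;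 (ii) draws an action $A^i_k\sim\pi^i_{k+1}$ (given the past, independently of the other player's draw) and receives the reward $\mathcal{R}^i(A^i_k,A^{-i}_k)$; (iii) sets $q^i_{k+1}(a)=q^i_k(a)+\alpha_k\mathbf{1}_{\{a=A^i_k\}}\bigl(\mathcal{R}^i(A^i_k,A^{-i}_k)-q^i_k(A^i_k)\bigr)$ for all $a\in\mathcal{A}^i$. The output after $K$ iterations is $(\pi^1_K,\pi^2_K)$. Each iteration uses one sample (one joint play), so $K$ iterations use $K$ samples. \textbf{Corollary (Sample complexity, matrix games).} There is a numerical constant $c_0>0$ such that the following holds. Let $A_{\max}\in\mathbb{N}$ and $\tau>0$, and put $\ell_\tau=[1+(A_{\max}-1)\exp(2/\tau)]^{-1}$. Let both players follow the DSBR dynamics with stepsizes $\alpha_k=\alpha/(k+h)$ and $\beta_k=c\,\alpha_k$, where $0<c<1$, $c\le \ell_\tau^3\tau^3/(c_0A_{\max}^2)$, $\alpha>2/c$ and $h>\alpha$. Then there is a constant $C>0$, depending only on $A_{\max},\tau,c,\alpha,h$, such that for every zero-sum matrix game as above whose larger action set has $A_{\max}$ elements, every $\epsilon>0$ and every integer $K\ge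 C/\epsilon$, $$\mathbb{E}[\mathrm{NG}(\pi^1_K,\pi^2_K)]\le\epsilon+2\tau\log(A_{\max}).$$ That is, an expected Nash gap of at most $\epsilon+2\tau\log(A_{\max})$ is reached with $\mathcal{O}(1/\epsilon)$ samples. -/

import Mathlib

noncomputable section

namespace DSBR

open Matrix

variable {A B : Type*} [Fintype A] [Fintype B]

/-- The softmax function with temperature `τ`. -/
def softmax (τ : ℝ) (q : A → ℝ) : A → ℝ :=
  fun a => Real.exp (q a / τ) / ∑ b, Real.exp (q b / τ)

/-- The Nash gap of the joint policy `(p₁, p₂)` in the zero-sum matrix game in which player 1 has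
payoff matrix `R` and player 2 has payoff matrix `-Rᵀ`. The suprema are over probability simplices;
for nonempty action sets they are maxima. -/
def nashGap (R : Matrix A B ℝ) (p₁ : A → ℝ) (p₂ : B → ℝ) : ℝ :=
  (⨆ x : stdSimplex ℝ A, ((x : A → ℝ) - p₁) ⬝ᵥ (R *ᵥ p₂)) +
    ⨆ y : stdSimplex ℝ B, ((y : B → ℝ) - p₂) ⬝ᵥ ((-Rᵀ) *ᵥ p₁)

/-- What one player stores: a policy and a local `q`-function. -/
structure Player (A : Type*) where
  policy : A → ℝ
  q : A → ℝ

/-- Initialization: uniform policy, zero `q`-function. -/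
def Player.init (A : Type*) [Fintype A] : Player A where
  policy := fun _ => 1 / (Fintype.card A : ℝ)
  q := fun _ => 0

/-- The smoothed policy update `π + β (σ_τ(q) - π)`. -/
def Player.nextPolicy (τ β : ℝ) (s : Player A) : A → ℝ :=
  fun a => s.policy a + β * (softmax τ s.q a - s.policy a)

/-- One iteration of a single player, who has played the action `a₀` (drawn from the updated
policy) and received the reward `r`. -/
def Player.step [DecidableEq A] (τ α β : ℝ) (s : Player A) (a₀ : A) (r : ℝ) : Player A where
  policy := s.nextPolicy τ β
  q := fun a => s.q a + α * (if a = a₀ then r - s.q a₀ else 0)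

theorem softmax_mem [Nonempty A] (τ : ℝ) (q : A → ℝ) : softmax τ q ∈ stdSimplex ℝ A := by
  have hpos : 0 < ∑ b, Real.exp (q b / τ) :=
    Finset.sum_pos (fun _ _ => Real.exp_pos _) Finset.univ_nonempty
  refine ⟨fun a => div_nonneg (Real.exp_pos _).le hpos.le, ?_⟩
  simp only [softmax]
  rw [← Finset.sum_div, div_self hpos.ne']

theorem nextPolicy_mem [Nonempty A] {τ β : ℝ} (h0 : 0 ≤ β) (h1 : β ≤ 1) {s : Player A}
    (hs : s.policy ∈ stdSimplex ℝ A) : s.nextPolicy τ β ∈ stdSimplex ℝ A := by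
  have := (convex_stdSimplex ℝ A) hs (softmax_mem τ s.q) (sub_nonneg.2 h1) h0 (by ring)
  convert this using 1
  ext a
  simp [Player.nextPolicy]
  ring

theorem init_mem [Nonempty A] : (Player.init A).policy ∈ stdSimplex ℝ A := by
  constructor
  · intro a; simp [Player.init]
  · simp [Player.init]

variable [DecidableEq A] [DecidableEq B]

/-- The states of the two players after `k` iterations of the dynamics with stepsizes `α_k`
(for the `q`-functions) and `β_k` (for the policies), as a function of the joint actions
`(A_0^1, A_0^2), …, (A_{k-1}^1, A_{k-1}^2)` that have been played. -/
def state (R : Matrix A B ℝ) (τ : ℝ) (α β : ℕ → ℝ) :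
    (k : ℕ) → (Fin k → A × B) → Player A × Player B
  | 0, _ => (Player.init A, Player.init B)
  | k + 1, hist =>
      let s := state R τ α β k (Fin.init hist)
      let a := (hist (Fin.last k)).1
      let b := (hist (Fin.last k)).2
      (s.1.step τ (α k) (β k) a (R a b), s.2.step τ (α k) (β k) b ((-Rᵀ) b a))

/-- The probability that the first `k` joint actions played are `hist`: in iteration `k`, given the
past, the two players draw their actions independently from their updated policies
`π_{k+1}^1` and `π_{k+1}^2`. -/
def prob (R : Matrix A B ℝ) (τ : ℝ) (α β : ℕ → ℝ) : (k : ℕ) → (Fin k → A × B) → ℝ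
  | 0, _ => 1
  | k + 1, hist =>
      let s := state R τ α β k (Fin.init hist)
      prob R τ α β k (Fin.init hist) *
        (s.1.nextPolicy τ (β k) (hist (Fin.last k)).1 *
          s.2.nextPolicy τ (β k) (hist (Fin.last k)).2)

/-- The expected Nash gap `𝔼[NG(π_K^1, π_K^2)]` of the policies produced by `K` iterations
(hence by `K` samples, one joint play per iteration). -/
def expectedNashGap (R : Matrix A B ℝ) (τ : ℝ) (α β : ℕ → ℝ) (K : ℕ) : ℝ :=
  ∑ hist : Fin K → A × B, prob R τ α β K hist *
    nashGap R (state R τ α β K hist).1.policy (state R τ α β K hist).2.policy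

/-- The constant `ℓ_τ = [1 + (A_max - 1) exp(2 / τ)]⁻¹`. -/
def ell (τ : ℝ) (Amax : ℕ) : ℝ := (1 + ((Amax : ℝ) - 1) * Real.exp (2 / τ))⁻¹

section

variable [Nonempty A] [Nonempty B]


theorem state_mem (R : Matrix A B ℝ) (τ : ℝ) (α β : ℕ → ℝ) (hβ : ∀ k, 0 ≤ β k ∧ β k ≤ 1) :
    ∀ (k : ℕ) (hist : Fin k → A × B), (state R τ α β k hist).1.policy ∈ stdSimplex ℝ A ∧
      (state R τ α β k hist).2.policy ∈ stdSimplex ℝ B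
  | 0, _ => ⟨init_mem, init_mem⟩
  | k + 1, hist =>
    have h := state_mem R τ α β hβ k (Fin.init hist)
    ⟨nextPolicy_mem (hβ k).1 (hβ k).2 h.1, nextPolicy_mem (hβ k).1 (hβ k).2 h.2⟩

theorem prob_nonneg (R : Matrix A B ℝ) (τ : ℝ) (α β : ℕ → ℝ) (hβ : ∀ k, 0 ≤ β k ∧ β k ≤ 1) :
    ∀ (k : ℕ) (hist : Fin k → A × B), 0 ≤ prob R τ α β k hist
  | 0, _ => zero_le_one
  | k + 1, hist =>
    have h := state_mem R τ α β hβ k (Fin.init hist)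
    mul_nonneg (prob_nonneg R τ α β hβ k _) (mul_nonneg
      ((nextPolicy_mem (hβ k).1 (hβ k).2 h.1).1 _) ((nextPolicy_mem (hβ k).1 (hβ k).2 h.2).1 _))

/-- For stepsizes `β_k ∈ [0, 1]`, `prob` is a probability mass function on the histories. -/
theorem sum_prob (R : Matrix A B ℝ) (τ : ℝ) (α β : ℕ → ℝ) (hβ : ∀ k, 0 ≤ β k ∧ β k ≤ 1) (k : ℕ) :
    ∑ hist : Fin k → A × B, prob R τ α β k hist = 1 := by
  induction k with
  | zero => simp [prob]
  | succ k ih =>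
    rw [← (Fin.snocEquiv (fun _ => A × B)).sum_comp, Fintype.sum_prod_type_right, ← ih]
    refine Finset.sum_congr rfl fun hist _ => ?_
    have h := state_mem R τ α β hβ k hist
    have e1 := (nextPolicy_mem (τ := τ) (hβ k).1 (hβ k).2 h.1).2
    have e2 := (nextPolicy_mem (τ := τ) (hβ k).1 (hβ k).2 h.2).2
    simp only [Fin.snocEquiv, Equiv.coe_fn_mk, prob, Fin.init_snoc, Fin.snoc_last]
    rw [← Finset.mul_sum, Fintype.sum_prod_type, ← Finset.sum_mul_sum, e1, e2]
    simp

end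

end DSBR

end

/-!
The argument is a Lyapunov analysis of the entropy-regularized game. The regularized Nash gap
`regGap` dominates the Nash gap up to `2 τ log Amax` (`nashGap_le_regGap_add`), which is the bias in
the bound; what remains is to show that its expectation decays like `1 / K`.

If the `q`-functions were exact payoff vectors, a policy update would be a step of smoothed best
response dynamics. In a zero-sum game the terms coupling the two players cancel, and the
regularized gap decreases at a rate given by `τ` times the symmetrized Kullback-Leibler divergences
between the policies and their smoothed best responses. This rate dominates both the regularized
gap itself and `τ` times the squared distances of the policies from the smoothed best responses
(`negEntropy_update_le`). Half of the decrease pays for the contraction of the gap, the other half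
for the effect of inexact `q`-functions (`regGap_update_le`). In the other direction, the sampled
`q`-update contracts the squared error in expectation at rate `α_k ℓ_τ`, because every action keeps
probability at least `ℓ_τ` (`expected_sqNorm_error_le`), while the motion of the policies disturbs it
at the slower rate `β_k = c α_k` (`sqNorm_error_update_le`). For `c` small the two couplings close:
the regularized gap plus a multiple of the squared error satisfies
`𝔼 U_{k+1} ≤ (1 - β_k / 2) 𝔼 U_k + O(α_k²)` (`expectStep_lyapunov_le`, `weights_balance`), and
`c α / 2 > 1` yields `𝔼 U_K = O(1 / K)` (`le_div_of_recursion`).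

The balance of the weights uses `τ ≤ 3 / 2`. For larger `τ` the bias `2 τ log Amax` is at least `2`,
which the Nash gap never exceeds, unless there is only one joint action and the gap is `0`
(`nashGap_le_of_high_temperature`).

The Lipschitz and convexity properties of softmax, log-sum-exp and entropy are all derived from the
inequality `log x ≤ x - 1` and the duality `logSumExp_sub_eq`, without derivatives.
-/

noncomputable section

namespace DSBR

open Matrix

section

variable {A B : Type*} [Fintype A] [Fintype B]

/-! ### Squared Euclidean norms and Young's inequality -/

/-- The squared Euclidean norm of a vector, used instead of the norm of `EuclideanSpace` so that
policies and `q`-functions can stay plain functions. -/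
def sqNorm (x : A → ℝ) : ℝ := x ⬝ᵥ x

theorem sqNorm_eq (x : A → ℝ) : sqNorm x = ∑ a, x a ^ 2 := by
  simp [sqNorm, dotProduct, sq]

theorem sqNorm_nonneg (x : A → ℝ) : 0 ≤ sqNorm x := by
  rw [sqNorm_eq]; positivity

theorem sqNorm_smul (t : ℝ) (x : A → ℝ) : sqNorm (t • x) = t ^ 2 * sqNorm x := by
  simp [sqNorm]; ring

theorem sqNorm_neg (x : A → ℝ) : sqNorm (-x) = sqNorm x := by
  simp [sqNorm]

theorem sqNorm_le_card {x : A → ℝ} (hx : ∀ a, |x a| ≤ 1) : sqNorm x ≤ Fintype.card A := by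
  rw [sqNorm_eq]
  calc ∑ a, x a ^ 2 ≤ ∑ _a : A, (1 : ℝ) :=
        Finset.sum_le_sum fun a _ => (sq_le_one_iff_abs_le_one _).2 (hx a)
    _ = _ := by simp

theorem dotProduct_le_young {t : ℝ} (ht : 0 < t) (x y : A → ℝ) :
    x ⬝ᵥ y ≤ t * sqNorm x + 1 / (4 * t) * sqNorm y := by
  rw [sqNorm_eq, sqNorm_eq, Finset.mul_sum, Finset.mul_sum, ← Finset.sum_add_distrib, dotProduct]
  refine Finset.sum_le_sum fun a _ => ?_
  have h : 0 ≤ t * (x a - y a / (2 * t)) ^ 2 := by positivity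
  have e : t * (x a - y a / (2 * t)) ^ 2
      = t * x a ^ 2 + 1 / (4 * t) * y a ^ 2 - x a * y a := by
    field_simp; ring
  linarith

theorem sqNorm_mulVec_le {R : Matrix A B ℝ} (hR : ∀ a b, |R a b| ≤ 1) {N : ℝ}
    (hA : (Fintype.card A : ℝ) ≤ N) (hB : (Fintype.card B : ℝ) ≤ N) (y : B → ℝ) :
    sqNorm (R *ᵥ y) ≤ N ^ 2 * sqNorm y := by
  have hy := sqNorm_nonneg y
  have hN : 0 ≤ N := le_trans (Nat.cast_nonneg _) hA
  have row : ∀ a, (R *ᵥ y) a ^ 2 ≤ N * sqNorm y := by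
    intro a
    have h1 : (R *ᵥ y) a ^ 2 ≤ (∑ b, R a b ^ 2) * ∑ b, y b ^ 2 :=
      Finset.sum_mul_sq_le_sq_mul_sq _ _ _
    have h2 : ∑ b, R a b ^ 2 ≤ N := by
      have := sqNorm_le_card (x := R a) (hR a)
      rw [sqNorm_eq] at this
      exact this.trans hB
    rw [← sqNorm_eq y] at h1
    exact h1.trans (mul_le_mul_of_nonneg_right h2 hy)
  calc sqNorm (R *ᵥ y) = ∑ a, (R *ᵥ y) a ^ 2 := sqNorm_eq _
    _ ≤ ∑ _a : A, N * sqNorm y := Finset.sum_le_sum fun a _ => row a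
    _ = Fintype.card A * (N * sqNorm y) := by simp
    _ ≤ N * (N * sqNorm y) := by gcongr
    _ = _ := by ring

theorem abs_neg_transpose_le {A B : Type*} {R : Matrix A B ℝ} (hR : ∀ a b, |R a b| ≤ 1) (b : B)
    (a : A) : |(-Rᵀ) b a| ≤ 1 := by
  simpa using hR a b

theorem abs_mulVec_le {A B : Type*} [Fintype B] {R : Matrix A B ℝ} (hR : ∀ a b, |R a b| ≤ 1)
    {p : B → ℝ} (hp : p ∈ stdSimplex ℝ B) (a : A) : |(R *ᵥ p) a| ≤ 1 := by
  calc |(R *ᵥ p) a| ≤ ∑ b, |R a b * p b| := Finset.abs_sum_le_sum_abs _ _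
    _ ≤ ∑ b, p b := by
      refine Finset.sum_le_sum fun b _ => ?_
      rw [abs_mul, abs_of_nonneg (hp.1 b)]
      exact mul_le_of_le_one_left (hp.1 b) (hR a b)
    _ = 1 := hp.2

theorem le_one_of_mem {p : A → ℝ} (hp : p ∈ stdSimplex ℝ A) (a : A) : p a ≤ 1 :=
  (mem_Icc_of_mem_stdSimplex hp a).2

theorem abs_sub_le_one {p s : A → ℝ} (hp : p ∈ stdSimplex ℝ A) (hs : s ∈ stdSimplex ℝ A) (a : A) :
    |(s - p) a| ≤ 1 := by
  rw [Pi.sub_apply, abs_le]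
  constructor <;> linarith [hp.1 a, hs.1 a, le_one_of_mem hp a, le_one_of_mem hs a]

theorem sum_sub_eq_zero {p s : A → ℝ} (hp : p ∈ stdSimplex ℝ A) (hs : s ∈ stdSimplex ℝ A) :
    ∑ a, (s - p) a = 0 := by
  simp [Finset.sum_sub_distrib, hp.2, hs.2]

/-! ### Logarithms on an interval bounded away from zero -/

theorem sq_sub_le_mul_log_sub {x y : ℝ} (hx : 0 < x) (hx1 : x ≤ 1) (hy : 0 < y) (hy1 : y ≤ 1) :
    (x - y) ^ 2 ≤ (x - y) * (Real.log x - Real.log y) := by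
  -- On `(0, 1]` the logarithm has slope at least `1`.
  have key : ∀ {s t : ℝ}, 0 < s → s ≤ t → t ≤ 1 → t - s ≤ Real.log t - Real.log s := by
    intro s t hs hst ht
    have ht0 := hs.trans_le hst
    have h := Real.log_le_sub_one_of_pos (div_pos hs ht0)
    rw [Real.log_div hs.ne' ht0.ne'] at h
    have h2 : (t - s) * 1 ≤ (t - s) * (1 / t) :=
      mul_le_mul_of_nonneg_left ((one_le_div ht0).2 ht) (by linarith)
    have h3 : (t - s) * (1 / t) = 1 - s / t := by field_simp
    linarith
  rcases le_total y x with h | h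
  · have := key hy h hx1; nlinarith
  · have := key hx h hy1; nlinarith

theorem sq_log_sub_le {x y l : ℝ} (hl : 0 < l) (hx : l ≤ x) (hy : l ≤ y) :
    (Real.log x - Real.log y) ^ 2 ≤ (x - y) ^ 2 / l ^ 2 := by
  -- On `[l, ∞)` the logarithm has slope at most `1 / l`.
  have key : ∀ {s t : ℝ}, l ≤ s → s ≤ t →
      Real.log t - Real.log s ≤ (t - s) / l ∧ 0 ≤ Real.log t - Real.log s := by
    intro s t hs hst
    have hs0 := hl.trans_le hs
    have ht0 := hs0.trans_le hst
    have h := Real.log_le_sub_one_of_pos (div_pos ht0 hs0)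
    rw [Real.log_div ht0.ne' hs0.ne'] at h
    have h2 : t / s - 1 = (t - s) / s := by field_simp
    have h3 : (t - s) / s ≤ (t - s) / l := div_le_div_of_nonneg_left (by linarith) hl hs
    have := Real.log_le_log hs0 hst
    constructor <;> linarith
  rw [← div_pow]
  rcases le_total y x with h | h
  · obtain ⟨h1, h2⟩ := key hy h
    exact pow_le_pow_left₀ h2 h1 2
  · obtain ⟨h1, h2⟩ := key hx h
    have := pow_le_pow_left₀ h2 h1 2
    calc _ = (Real.log y - Real.log x) ^ 2 := by ring
      _ ≤ _ := this
      _ = _ := by ring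

theorem mul_log_sub_ge {x y : ℝ} (hx : 0 < x) (hy : 0 < y) :
    x - y ≤ x * (Real.log x - Real.log y) := by
  have h := Real.log_le_sub_one_of_pos (div_pos hy hx)
  rw [Real.log_div hy.ne' hx.ne'] at h
  have h2 := mul_le_mul_of_nonneg_left h hx.le
  have h3 : x * (y / x - 1) = y - x := by field_simp
  linarith

/-! ### Softmax, its potential and the negative entropy -/

/-- The potential `τ log ∑ exp (u / τ)` of the softmax function: the maximum of
`⟨p, u⟩ - τ * negEntropy p` over the simplex. -/
def logSumExp (τ : ℝ) (u : A → ℝ) : ℝ := τ * Real.log (∑ a, Real.exp (u a / τ))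

/-- The negative Shannon entropy. -/
def negEntropy (p : A → ℝ) : ℝ := ∑ a, p a * Real.log (p a)

theorem sum_exp_pos [Nonempty A] (τ : ℝ) (u : A → ℝ) : 0 < ∑ a, Real.exp (u a / τ) :=
  Finset.sum_pos (fun _ _ => Real.exp_pos _) Finset.univ_nonempty

theorem softmax_pos [Nonempty A] (τ : ℝ) (u : A → ℝ) (a : A) : 0 < softmax τ u a :=
  div_pos (Real.exp_pos _) (sum_exp_pos τ u)

theorem log_softmax [Nonempty A] {τ : ℝ} (hτ : 0 < τ) (u : A → ℝ) (a : A) :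
    τ * Real.log (softmax τ u a) = u a - logSumExp τ u := by
  rw [softmax, Real.log_div (Real.exp_pos _).ne' (sum_exp_pos τ u).ne', Real.log_exp, logSumExp]
  field_simp

/-- The duality gap between `logSumExp` and the negative entropy is a Kullback-Leibler
divergence. -/
theorem logSumExp_sub_eq [Nonempty A] {τ : ℝ} (hτ : 0 < τ) (u : A → ℝ) {p : A → ℝ}
    (hp : p ∈ stdSimplex ℝ A) :
    logSumExp τ u - p ⬝ᵥ u + τ * negEntropy p
      = τ * ∑ a, p a * (Real.log (p a) - Real.log (softmax τ u a)) := by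
  have h : ∀ a, τ * (p a * (Real.log (p a) - Real.log (softmax τ u a)))
      = τ * (p a * Real.log (p a)) - p a * u a + p a * logSumExp τ u := by
    intro a
    have := log_softmax hτ u a
    linear_combination (-p a) * this
  rw [Finset.mul_sum, Finset.sum_congr rfl fun a _ => h a, Finset.sum_add_distrib,
    Finset.sum_sub_distrib, ← Finset.mul_sum, ← Finset.sum_mul, hp.2, negEntropy, dotProduct]
  ring

theorem sum_mul_log_sub_nonneg {p s : A → ℝ} (hp : p ∈ stdSimplex ℝ A) (hs : s ∈ stdSimplex ℝ A)
    (hp0 : ∀ a, 0 < p a) (hs0 : ∀ a, 0 < s a) :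
    0 ≤ ∑ a, p a * (Real.log (p a) - Real.log (s a)) := by
  calc (0 : ℝ) = ∑ a, (p a - s a) := by simp [Finset.sum_sub_distrib, hp.2, hs.2]
    _ ≤ _ := Finset.sum_le_sum fun a _ => mul_log_sub_ge (hp0 a) (hs0 a)

theorem dotProduct_le_logSumExp [Nonempty A] {τ : ℝ} (hτ : 0 < τ) (u : A → ℝ) {p : A → ℝ}
    (hp : p ∈ stdSimplex ℝ A) (hp0 : ∀ a, 0 < p a) :
    p ⬝ᵥ u - τ * negEntropy p ≤ logSumExp τ u := by
  have h1 := logSumExp_sub_eq hτ u hp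
  have h2 := mul_nonneg hτ.le
    (sum_mul_log_sub_nonneg hp (softmax_mem τ u) hp0 (softmax_pos τ u))
  linarith

theorem logSumExp_eq [Nonempty A] {τ : ℝ} (hτ : 0 < τ) (u : A → ℝ) :
    logSumExp τ u = softmax τ u ⬝ᵥ u - τ * negEntropy (softmax τ u) := by
  have h1 := logSumExp_sub_eq hτ u (softmax_mem τ u)
  simp only [sub_self, mul_zero, Finset.sum_const_zero] at h1
  linarith

/-- The softmax function is `1 / τ`-Lipschitz: pair the difference of two softmax policies with the
difference of their logarithms, and use that the logarithm is strongly monotone on `(0, 1]`. -/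
theorem sqNorm_softmax_sub_le [Nonempty A] {τ : ℝ} (hτ : 0 < τ) (q u : A → ℝ) :
    sqNorm (softmax τ q - softmax τ u) ≤ sqNorm (q - u) / τ ^ 2 := by
  set x := softmax τ q - softmax τ u
  have h1 : τ * sqNorm x ≤ x ⬝ᵥ (q - u) := by
    have e : x ⬝ᵥ (q - u)
        = ∑ a, τ * (x a * (Real.log (softmax τ q a) - Real.log (softmax τ u a))) := by
      have h : ∀ a, τ * (x a * (Real.log (softmax τ q a) - Real.log (softmax τ u a)))
          = x a * (q - u) a + x a * (logSumExp τ u - logSumExp τ q) := by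
        intro a
        have e1 := log_softmax hτ u a
        have e2 := log_softmax hτ q a
        rw [Pi.sub_apply]
        linear_combination (x a) * e2 - (x a) * e1
      rw [Finset.sum_congr rfl fun a _ => h a, Finset.sum_add_distrib, ← Finset.sum_mul,
        sum_sub_eq_zero (softmax_mem τ u) (softmax_mem τ q)]
      simp [dotProduct]
    rw [e, sqNorm_eq, Finset.mul_sum]
    refine Finset.sum_le_sum fun a _ => mul_le_mul_of_nonneg_left ?_ hτ.le
    exact sq_sub_le_mul_log_sub (softmax_pos _ _ _) (le_one_of_mem (softmax_mem _ _) a)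
      (softmax_pos _ _ _) (le_one_of_mem (softmax_mem _ _) a)
  have h2 := dotProduct_le_young (t := τ / 2) (by positivity) x (q - u)
  have h3 : τ / 2 * sqNorm x ≤ 1 / (4 * (τ / 2)) * sqNorm (q - u) := by linarith
  rw [le_div_iff₀ (by positivity)]
  have h4 := mul_le_mul_of_nonneg_left h3 (by positivity : 0 ≤ 2 * τ)
  have e1 : 2 * τ * (τ / 2 * sqNorm x) = sqNorm x * τ ^ 2 := by ring
  have e2 : 2 * τ * (1 / (4 * (τ / 2)) * sqNorm (q - u)) = sqNorm (q - u) := by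
    field_simp; ring
  linarith

/-- Smoothness of `logSumExp`: its gradient is the softmax function, which is Lipschitz. -/
theorem logSumExp_add_le [Nonempty A] {τ : ℝ} (hτ : 0 < τ) (u v : A → ℝ) :
    logSumExp τ (u + v) ≤ logSumExp τ u + softmax τ u ⬝ᵥ v + sqNorm v / τ := by
  have h1 := logSumExp_eq hτ (u + v)
  have h2 := dotProduct_le_logSumExp hτ u (softmax_mem τ (u + v)) (softmax_pos τ (u + v))
  have h3 := sqNorm_softmax_sub_le hτ (u + v) u
  have h4 := dotProduct_le_young (t := τ / 2) (by positivity)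
    (softmax τ (u + v) - softmax τ u) v
  rw [add_sub_cancel_left] at h3
  rw [dotProduct_add] at h1
  rw [sub_dotProduct] at h4
  have h5 : τ / 2 * sqNorm (softmax τ (u + v) - softmax τ u) ≤ τ / 2 * (sqNorm v / τ ^ 2) := by
    gcongr
  have e : τ / 2 * (sqNorm v / τ ^ 2) + 1 / (4 * (τ / 2)) * sqNorm v = sqNorm v / τ := by
    field_simp; ring
  linarith

/-- Smoothness of the negative entropy on the policies bounded below by `l`. -/
theorem negEntropy_le {p r : A → ℝ} {l : ℝ} (hl : 0 < l) (hp : ∀ a, l ≤ p a) (hr : ∀ a, l ≤ r a)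
    (hsum : ∑ a, (r - p) a = 0) :
    negEntropy r ≤ negEntropy p + (fun a => Real.log (p a)) ⬝ᵥ (r - p) + sqNorm (r - p) / l := by
  have h : ∀ a, r a * Real.log (r a) ≤ p a * Real.log (p a) + Real.log (p a) * (r - p) a
      + (r - p) a + (r - p) a ^ 2 / l := by
    intro a
    have hp0 := hl.trans_le (hp a)
    have hr0 := hl.trans_le (hr a)
    have h := Real.log_le_sub_one_of_pos (div_pos hr0 hp0)
    rw [Real.log_div hr0.ne' hp0.ne'] at h
    have h1 := mul_le_mul_of_nonneg_left h hr0.le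
    have h2 : r a * (r a / p a - 1) = (r - p) a + (r - p) a ^ 2 / p a := by
      rw [Pi.sub_apply]; field_simp; ring
    have h3 : (r - p) a ^ 2 / p a ≤ (r - p) a ^ 2 / l :=
      div_le_div_of_nonneg_left (sq_nonneg _) hl (hp a)
    rw [Pi.sub_apply] at *
    linarith
  calc negEntropy r ≤ ∑ a, (p a * Real.log (p a) + Real.log (p a) * (r - p) a
      + (r - p) a + (r - p) a ^ 2 / l) := Finset.sum_le_sum fun a _ => h a
    _ = _ := by
      rw [Finset.sum_add_distrib, Finset.sum_add_distrib, Finset.sum_add_distrib, hsum,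
        ← Finset.sum_div, ← sqNorm_eq, negEntropy, dotProduct]
      ring

end

section

variable {A B : Type*} [Fintype A] [Fintype B]

/-! ### The Nash gap and its entropic regularization -/

/-- The Nash gap of the game in which both payoffs are regularized by `τ` times the Shannon
entropy. The payoffs of the two players against each other cancel. -/
def regGap (τ : ℝ) (R : Matrix A B ℝ) (p₁ : A → ℝ) (p₂ : B → ℝ) : ℝ :=
  logSumExp τ (R *ᵥ p₂) + logSumExp τ ((-Rᵀ) *ᵥ p₁) + τ * (negEntropy p₁ + negEntropy p₂)

theorem dotProduct_neg_transpose_mulVec (R : Matrix A B ℝ) (x : A → ℝ) (y : B → ℝ) :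
    y ⬝ᵥ ((-Rᵀ) *ᵥ x) = -(x ⬝ᵥ (R *ᵥ y)) := by
  rw [neg_mulVec, dotProduct_neg, dotProduct_mulVec, vecMul_transpose, dotProduct_comm]

theorem dotProduct_le_of_mem {x u : A → ℝ} {m : ℝ} (hx : x ∈ stdSimplex ℝ A) (hu : ∀ a, u a ≤ m) :
    x ⬝ᵥ u ≤ m := by
  calc x ⬝ᵥ u ≤ ∑ a, x a * m :=
        Finset.sum_le_sum fun a _ => mul_le_mul_of_nonneg_left (hu a) (hx.1 a)
    _ = m := by rw [← Finset.sum_mul, hx.2, one_mul]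

theorem le_logSumExp {τ : ℝ} (hτ : 0 < τ) (u : A → ℝ) (a : A) : u a ≤ logSumExp τ u := by
  have h : Real.exp (u a / τ) ≤ ∑ b, Real.exp (u b / τ) :=
    Finset.single_le_sum (f := fun b => Real.exp (u b / τ))
      (fun b _ => (Real.exp_pos _).le) (Finset.mem_univ a)
  have h2 := Real.log_le_log (Real.exp_pos _) h
  rw [Real.log_exp, div_le_iff₀ hτ] at h2
  rw [logSumExp]; linarith

theorem logSumExp_le [Nonempty A] {τ N : ℝ} (hτ : 0 < τ) (hN : (Fintype.card A : ℝ) ≤ N)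
    {u : A → ℝ} (hu : ∀ a, u a ≤ 1) : logSumExp τ u ≤ 1 + τ * Real.log N := by
  have hc : (0 : ℝ) < Fintype.card A := by exact_mod_cast Fintype.card_pos
  have h : ∑ a, Real.exp (u a / τ) ≤ N * Real.exp (1 / τ) := by
    calc ∑ a, Real.exp (u a / τ) ≤ ∑ _a : A, Real.exp (1 / τ) :=
          Finset.sum_le_sum fun a _ => Real.exp_le_exp.2 (by gcongr; exact hu a)
      _ = Fintype.card A * Real.exp (1 / τ) := by simp
      _ ≤ _ := by gcongr
  have h2 := Real.log_le_log (sum_exp_pos τ u) h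
  rw [Real.log_mul (hc.trans_le hN).ne' (Real.exp_pos _).ne', Real.log_exp] at h2
  have h3 := mul_le_mul_of_nonneg_left h2 hτ.le
  have e : τ * (Real.log N + 1 / τ) = 1 + τ * Real.log N := by field_simp; ring
  rw [logSumExp]; linarith

theorem negEntropy_nonpos {p : A → ℝ} (hp : p ∈ stdSimplex ℝ A) : negEntropy p ≤ 0 :=
  Finset.sum_nonpos fun a _ =>
    mul_nonpos_of_nonneg_of_nonpos (hp.1 a) (Real.log_nonpos (hp.1 a) (le_one_of_mem hp a))

theorem neg_log_card_le_negEntropy [Nonempty A] {τ N : ℝ} (hτ : 0 < τ)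
    (hN : (Fintype.card A : ℝ) ≤ N) {p : A → ℝ} (hp : p ∈ stdSimplex ℝ A) (hp0 : ∀ a, 0 < p a) :
    -(τ * Real.log N) ≤ τ * negEntropy p := by
  have h := dotProduct_le_logSumExp hτ (0 : A → ℝ) hp hp0
  have hc : (0 : ℝ) < Fintype.card A := by exact_mod_cast Fintype.card_pos
  have h2 : logSumExp τ (0 : A → ℝ) ≤ τ * Real.log N := by
    simp only [logSumExp, Pi.zero_apply, zero_div, Real.exp_zero, Finset.sum_const,
      Finset.card_univ, nsmul_eq_mul, mul_one]
    gcongr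
  rw [dotProduct_zero] at h
  linarith

/-- Since the game is zero-sum, the payoffs of the two players against each other cancel in the Nash
gap, and it suffices to bound the two best-response values. -/
theorem nashGap_le [Nonempty A] [Nonempty B] (R : Matrix A B ℝ) {p₁ : A → ℝ} {p₂ : B → ℝ}
    {m₁ m₂ : ℝ} (h₁ : ∀ a, (R *ᵥ p₂) a ≤ m₁) (h₂ : ∀ b, ((-Rᵀ) *ᵥ p₁) b ≤ m₂) :
    nashGap R p₁ p₂ ≤ m₁ + m₂ := by
  have e := dotProduct_neg_transpose_mulVec R p₁ p₂
  have : Nonempty (stdSimplex ℝ A) := ⟨⟨_, init_mem⟩⟩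
  have : Nonempty (stdSimplex ℝ B) := ⟨⟨_, init_mem⟩⟩
  have b₁ : (⨆ x : stdSimplex ℝ A, ((x : A → ℝ) - p₁) ⬝ᵥ (R *ᵥ p₂)) ≤ m₁ - p₁ ⬝ᵥ (R *ᵥ p₂) := by
    refine ciSup_le fun x => ?_
    rw [sub_dotProduct]
    have h : (x : A → ℝ) ⬝ᵥ (R *ᵥ p₂) ≤ m₁ := dotProduct_le_of_mem x.2 h₁
    linarith
  have b₂ : (⨆ y : stdSimplex ℝ B, ((y : B → ℝ) - p₂) ⬝ᵥ ((-Rᵀ) *ᵥ p₁))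
      ≤ m₂ - p₂ ⬝ᵥ ((-Rᵀ) *ᵥ p₁) := by
    refine ciSup_le fun y => ?_
    rw [sub_dotProduct]
    have h : (y : B → ℝ) ⬝ᵥ ((-Rᵀ) *ᵥ p₁) ≤ m₂ := dotProduct_le_of_mem y.2 h₂
    linarith
  rw [nashGap]
  linarith

theorem nashGap_le_two [Nonempty A] [Nonempty B] {R : Matrix A B ℝ} (hR : ∀ a b, |R a b| ≤ 1)
    {p₁ : A → ℝ} {p₂ : B → ℝ} (hp₁ : p₁ ∈ stdSimplex ℝ A) (hp₂ : p₂ ∈ stdSimplex ℝ B) :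
    nashGap R p₁ p₂ ≤ 2 := by
  have := nashGap_le R (fun a => (abs_le.1 (abs_mulVec_le hR hp₂ a)).2)
    (fun b => (abs_le.1 (abs_mulVec_le (abs_neg_transpose_le hR) hp₁ b)).2)
  linarith

theorem nashGap_le_zero_of_subsingleton [Nonempty A] [Nonempty B] [Subsingleton A] [Subsingleton B]
    (R : Matrix A B ℝ) {p₁ : A → ℝ} {p₂ : B → ℝ} (hp₁ : p₁ ∈ stdSimplex ℝ A)
    (hp₂ : p₂ ∈ stdSimplex ℝ B) : nashGap R p₁ p₂ ≤ 0 := by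
  obtain ⟨a⟩ := ‹Nonempty A›
  obtain ⟨b⟩ := ‹Nonempty B›
  have h₁ : p₁ a = 1 := by simpa [Fintype.sum_subsingleton _ a] using hp₁.2
  have h₂ : p₂ b = 1 := by simpa [Fintype.sum_subsingleton _ b] using hp₂.2
  have := nashGap_le R (p₁ := p₁) (p₂ := p₂) (m₁ := R a b) (m₂ := -R a b)
    (fun a' => by
      simp [mulVec, dotProduct, Fintype.sum_subsingleton _ b, h₂, Subsingleton.elim a' a])
    (fun b' => by
      simp [mulVec, dotProduct, Fintype.sum_subsingleton _ a, h₁, Subsingleton.elim b' b])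
  linarith

theorem nashGap_le_regGap_add [Nonempty A] [Nonempty B] {τ N : ℝ} (hτ : 0 < τ)
    (hA : (Fintype.card A : ℝ) ≤ N) (hB : (Fintype.card B : ℝ) ≤ N) (R : Matrix A B ℝ)
    {p₁ : A → ℝ} {p₂ : B → ℝ} (hp₁ : p₁ ∈ stdSimplex ℝ A) (hp₂ : p₂ ∈ stdSimplex ℝ B)
    (h₁ : ∀ a, 0 < p₁ a) (h₂ : ∀ b, 0 < p₂ b) :
    nashGap R p₁ p₂ ≤ regGap τ R p₁ p₂ + 2 * τ * Real.log N := by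
  have h := nashGap_le R (le_logSumExp hτ (R *ᵥ p₂)) (le_logSumExp hτ ((-Rᵀ) *ᵥ p₁))
  have e₁ := neg_log_card_le_negEntropy hτ hA hp₁ h₁
  have e₂ := neg_log_card_le_negEntropy hτ hB hp₂ h₂
  rw [regGap]
  linarith

theorem regGap_le [Nonempty A] [Nonempty B] {τ N : ℝ} (hτ : 0 < τ)
    (hA : (Fintype.card A : ℝ) ≤ N) (hB : (Fintype.card B : ℝ) ≤ N) {R : Matrix A B ℝ}
    (hR : ∀ a b, |R a b| ≤ 1)
    {p₁ : A → ℝ} {p₂ : B → ℝ} (hp₁ : p₁ ∈ stdSimplex ℝ A) (hp₂ : p₂ ∈ stdSimplex ℝ B) :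
    regGap τ R p₁ p₂ ≤ 2 + 2 * τ * Real.log N := by
  have h₁ := logSumExp_le hτ hA fun a => (abs_le.1 (abs_mulVec_le hR hp₂ a)).2
  have h₂ := logSumExp_le hτ hB
    fun b => (abs_le.1 (abs_mulVec_le (abs_neg_transpose_le hR) hp₁ b)).2
  have := mul_nonpos_of_nonneg_of_nonpos hτ.le
    (add_nonpos (negEntropy_nonpos hp₁) (negEntropy_nonpos hp₂))
  rw [regGap]
  linarith

/-! ### Decrease of the regularized gap under the policy update -/

/-- The change of one player's negative entropy in a policy update from `p` towards `softmax τ q`,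
when the payoff vector is `u`. Since `log (softmax τ u)` is `u / τ` up to a constant, moving towards
the exact smoothed best response `softmax τ u` changes the entropy term, apart from the linear
payoff `⟨u, d⟩`, by `-τ` times the sum of the two Kullback-Leibler divergences between `p` and
`softmax τ u`. Half of that sum bounds half of the duality gap, the other half bounds a multiple of
the squared distance. The error of `q` enters through Young's inequality. -/
theorem negEntropy_update_le [Nonempty A] {τ l N β : ℝ} (hτ : 0 < τ) (hl : 0 < l) (hβ : 0 ≤ β)
    (hN : (Fintype.card A : ℝ) ≤ N) {p q u : A → ℝ} (hp : p ∈ stdSimplex ℝ A)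
    (hpl : ∀ a, l ≤ p a) (hul : ∀ a, l ≤ softmax τ u a)
    (hrl : ∀ a, l ≤ (p + β • (softmax τ q - p)) a) :
    τ * negEntropy (p + β • (softmax τ q - p)) ≤ τ * negEntropy p
      + β * (u ⬝ᵥ (softmax τ q - p) - (logSumExp τ u - p ⬝ᵥ u + τ * negEntropy p) / 2
        - 7 * τ / 16 * sqNorm (softmax τ u - p) + 4 / (l ^ 2 * τ) * sqNorm (q - u))
      + β ^ 2 * (τ * N / l) := by
  set σ := softmax τ q with hσ
  set s := softmax τ u with hs
  set d := σ - p with hd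
  have hσm : σ ∈ stdSimplex ℝ A := softmax_mem τ q
  have hsm : s ∈ stdSimplex ℝ A := softmax_mem τ u
  have hp0 : ∀ a, 0 < p a := fun a => hl.trans_le (hpl a)
  have hs0 : ∀ a, 0 < s a := softmax_pos τ u
  have hd0 : ∑ a, d a = 0 := sum_sub_eq_zero hp hσm
  have hsmooth := negEntropy_le (r := p + β • d) hl hpl hrl (by
    simp [add_sub_cancel_left, ← Finset.mul_sum, hd0])
  rw [add_sub_cancel_left, sqNorm_smul, dotProduct_smul, smul_eq_mul] at hsmooth
  have hdN : sqNorm d ≤ N := (sqNorm_le_card (abs_sub_le_one hp hσm)).trans hN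
  set g : A → ℝ := fun a => Real.log (p a) - Real.log (s a) with hg
  -- `log s` is `u / τ` up to a constant, which `d` annihilates
  have hlin : τ * ((fun a => Real.log (p a)) ⬝ᵥ d) = τ * (g ⬝ᵥ d) + u ⬝ᵥ d := by
    have h : ∀ a, τ * (Real.log (p a) * d a)
        = τ * (g a * d a) + u a * d a - logSumExp τ u * d a := by
      intro a
      have := log_softmax hτ u a
      simp only [hg, hs]
      linear_combination (d a) * this
    rw [dotProduct, Finset.mul_sum, Finset.sum_congr rfl fun a _ => h a, Finset.sum_sub_distrib,
      Finset.sum_add_distrib, ← Finset.mul_sum, ← Finset.mul_sum, hd0]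
    simp [dotProduct]
  have hsplit : g ⬝ᵥ d = -(g ⬝ᵥ (p - s)) + g ⬝ᵥ (σ - s) := by
    rw [← dotProduct_neg, ← dotProduct_add]
    congr 1
    rw [hd]; abel
  have hJ : g ⬝ᵥ (p - s) = ∑ a, p a * g a + ∑ a, s a * (Real.log (s a) - Real.log (p a)) := by
    rw [dotProduct, ← Finset.sum_add_distrib]
    refine Finset.sum_congr rfl fun a _ => ?_
    simp only [hg, Pi.sub_apply]; ring
  have hKL := sum_mul_log_sub_nonneg hsm hp hs0 hp0
  have hG := logSumExp_sub_eq hτ u hp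
  have hquad : sqNorm (s - p) ≤ g ⬝ᵥ (p - s) := by
    rw [sqNorm_eq]
    refine Finset.sum_le_sum fun a _ => ?_
    have := sq_sub_le_mul_log_sub (hp0 a) (le_one_of_mem hp a) (hs0 a) (le_one_of_mem hsm a)
    simp only [hg, Pi.sub_apply]
    nlinarith
  have hgn : sqNorm g ≤ sqNorm (s - p) / l ^ 2 := by
    rw [sqNorm_eq, sqNorm_eq, Finset.sum_div]
    refine Finset.sum_le_sum fun a _ => ?_
    have := sq_log_sub_le hl (hpl a) (hul a)
    simp only [hg, Pi.sub_apply]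
    rwa [← neg_sub (p a) (s a), neg_sq]
  have hw := sqNorm_softmax_sub_le hτ q u
  have hY := dotProduct_le_young (t := l ^ 2 / 16) (by positivity) g (σ - s)
  have hY2 : τ * (g ⬝ᵥ (σ - s)) ≤ τ / 16 * sqNorm (s - p) + 4 / (l ^ 2 * τ) * sqNorm (q - u) := by
    calc τ * (g ⬝ᵥ (σ - s))
        ≤ τ * (l ^ 2 / 16 * (sqNorm (s - p) / l ^ 2)
          + 1 / (4 * (l ^ 2 / 16)) * (sqNorm (q - u) / τ ^ 2)) := by
          refine mul_le_mul_of_nonneg_left (hY.trans ?_) hτ.le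
          gcongr
      _ = _ := by field_simp; ring
  have hJ1 : (logSumExp τ u - p ⬝ᵥ u + τ * negEntropy p) ≤ τ * (g ⬝ᵥ (p - s)) := by
    rw [hG, hJ]
    exact mul_le_mul_of_nonneg_left (le_add_of_nonneg_right hKL) hτ.le
  have hJ2 : τ * sqNorm (s - p) ≤ τ * (g ⬝ᵥ (p - s)) := mul_le_mul_of_nonneg_left hquad hτ.le
  have hdrift : τ * ((fun a => Real.log (p a)) ⬝ᵥ d)
      ≤ u ⬝ᵥ d - (logSumExp τ u - p ⬝ᵥ u + τ * negEntropy p) / 2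
        - 7 * τ / 16 * sqNorm (s - p) + 4 / (l ^ 2 * τ) * sqNorm (q - u) := by
    rw [hlin, hsplit]
    linarith
  have h1 := mul_le_mul_of_nonneg_left hsmooth hτ.le
  have h2 := mul_le_mul_of_nonneg_left hdrift hβ
  have h3 : τ * (β ^ 2 * sqNorm d / l) ≤ β ^ 2 * (τ * N / l) := by
    calc τ * (β ^ 2 * sqNorm d / l) ≤ τ * (β ^ 2 * N / l) := by gcongr
      _ = _ := by ring
  linarith

theorem cross_term_le [Nonempty B] {τ N : ℝ} (hτ : 0 < τ) {R : Matrix A B ℝ}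
    (hR : ∀ a b, |R a b| ≤ 1) (hA : (Fintype.card A : ℝ) ≤ N) (hB : (Fintype.card B : ℝ) ≤ N)
    (z : A → ℝ) (q u : B → ℝ) :
    z ⬝ᵥ (R *ᵥ (softmax τ q - softmax τ u))
      ≤ τ / 16 * sqNorm z + 4 * N ^ 2 / τ ^ 3 * sqNorm (q - u) := by
  have h := dotProduct_le_young (t := τ / 16) (by positivity) z
    (R *ᵥ (softmax τ q - softmax τ u))
  have h1 := sqNorm_mulVec_le hR hA hB (softmax τ q - softmax τ u)
  have h2 := sqNorm_softmax_sub_le hτ q u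
  calc _ ≤ _ := h
    _ ≤ τ / 16 * sqNorm z + 1 / (4 * (τ / 16)) * (N ^ 2 * (sqNorm (q - u) / τ ^ 2)) := by
      gcongr; exact h1.trans (by gcongr)
    _ = _ := by field_simp; ring

/-- Decrease of the regularized gap. The game being zero-sum, the terms that couple the two
players' updates cancel up to the error of the `q`-functions. -/
theorem regGap_update_le [Nonempty A] [Nonempty B] {τ l N β : ℝ} (hτ : 0 < τ) (hl : 0 < l)
    (hβ : 0 ≤ β) (hA : (Fintype.card A : ℝ) ≤ N) (hB : (Fintype.card B : ℝ) ≤ N)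
    {R : Matrix A B ℝ} (hR : ∀ a b, |R a b| ≤ 1)
    {p₁ q₁ : A → ℝ} {p₂ q₂ : B → ℝ} (hp₁ : p₁ ∈ stdSimplex ℝ A) (hp₂ : p₂ ∈ stdSimplex ℝ B)
    (hl₁ : ∀ a, l ≤ p₁ a) (hl₂ : ∀ b, l ≤ p₂ b)
    (hs₁ : ∀ a, l ≤ softmax τ (R *ᵥ p₂) a) (hs₂ : ∀ b, l ≤ softmax τ ((-Rᵀ) *ᵥ p₁) b)
    (hr₁ : ∀ a, l ≤ (p₁ + β • (softmax τ q₁ - p₁)) a)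
    (hr₂ : ∀ b, l ≤ (p₂ + β • (softmax τ q₂ - p₂)) b) :
    regGap τ R (p₁ + β • (softmax τ q₁ - p₁)) (p₂ + β • (softmax τ q₂ - p₂))
      ≤ (1 - β / 2) * regGap τ R p₁ p₂
        + β * (-(3 * τ / 8) * (sqNorm (softmax τ (R *ᵥ p₂) - p₁)
            + sqNorm (softmax τ ((-Rᵀ) *ᵥ p₁) - p₂))
          + (4 * N ^ 2 / τ ^ 3 + 4 / (l ^ 2 * τ)) * (sqNorm (q₁ - R *ᵥ p₂)
            + sqNorm (q₂ - (-Rᵀ) *ᵥ p₁)))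
        + β ^ 2 * (2 * (N ^ 3 / τ + τ * N / l)) := by
  have hR' := abs_neg_transpose_le hR
  have hN : 0 ≤ N := le_trans (Nat.cast_nonneg _) hA
  set u₁ := R *ᵥ p₂ with hu₁
  set u₂ := (-Rᵀ) *ᵥ p₁ with hu₂
  set d₁ := softmax τ q₁ - p₁ with hd₁
  set d₂ := softmax τ q₂ - p₂ with hd₂
  have n₁ := negEntropy_update_le (q := q₁) (u := u₁) hτ hl hβ hA hp₁ hl₁ hs₁ hr₁
  have n₂ := negEntropy_update_le (q := q₂) (u := u₂) hτ hl hβ hB hp₂ hl₂ hs₂ hr₂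
  have f₁ := logSumExp_add_le hτ u₁ (β • (R *ᵥ d₂))
  have f₂ := logSumExp_add_le hτ u₂ (β • ((-Rᵀ) *ᵥ d₁))
  have c₁ := cross_term_le hτ hR hA hB (softmax τ u₁ - p₁) q₂ u₂
  have c₂ := cross_term_le hτ hR' hB hA (softmax τ u₂ - p₂) q₁ u₁
  have b₁ : sqNorm (R *ᵥ d₂) ≤ N ^ 3 := by
    have h := (sqNorm_le_card (abs_sub_le_one hp₂ (softmax_mem τ q₂))).trans hB
    calc _ ≤ N ^ 2 * sqNorm d₂ := sqNorm_mulVec_le hR hA hB d₂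
      _ ≤ N ^ 2 * N := by gcongr
      _ = _ := by ring
  have b₂ : sqNorm ((-Rᵀ) *ᵥ d₁) ≤ N ^ 3 := by
    have h := (sqNorm_le_card (abs_sub_le_one hp₁ (softmax_mem τ q₁))).trans hA
    calc _ ≤ N ^ 2 * sqNorm d₁ := sqNorm_mulVec_le hR' hB hA d₁
      _ ≤ N ^ 2 * N := by gcongr
      _ = _ := by ring
  rw [sqNorm_smul, dotProduct_smul, smul_eq_mul] at f₁ f₂
  have g₁ : β ^ 2 * sqNorm (R *ᵥ d₂) / τ ≤ β ^ 2 * (N ^ 3 / τ) := by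
    rw [mul_div_assoc]; gcongr
  have g₂ : β ^ 2 * sqNorm ((-Rᵀ) *ᵥ d₁) / τ ≤ β ^ 2 * (N ^ 3 / τ) := by
    rw [mul_div_assoc]; gcongr
  -- the zero-sum cancellation
  have key : softmax τ u₁ ⬝ᵥ (R *ᵥ d₂) + softmax τ u₂ ⬝ᵥ ((-Rᵀ) *ᵥ d₁) + u₁ ⬝ᵥ d₁ + u₂ ⬝ᵥ d₂
      = (softmax τ u₁ - p₁) ⬝ᵥ (R *ᵥ (softmax τ q₂ - softmax τ u₂))
        + (softmax τ u₂ - p₂) ⬝ᵥ ((-Rᵀ) *ᵥ (softmax τ q₁ - softmax τ u₁)) := by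
    rw [dotProduct_comm u₁, dotProduct_comm u₂, hu₁, hu₂, hd₁, hd₂]
    simp only [dotProduct_neg_transpose_mulVec, mulVec_sub, dotProduct_sub, sub_dotProduct]
    ring
  have cancel : p₁ ⬝ᵥ u₁ + p₂ ⬝ᵥ u₂ = 0 := by
    rw [hu₂, dotProduct_neg_transpose_mulVec]; simp [hu₁]
  have key2 := mul_le_mul_of_nonneg_left (add_le_add c₁ c₂) hβ
  rw [← key] at key2
  rw [regGap, regGap, mulVec_add, mulVec_add, mulVec_smul, mulVec_smul, ← hu₁, ← hu₂]
  have cancel2 : β * (p₁ ⬝ᵥ u₁ + p₂ ⬝ᵥ u₂) = 0 := by rw [cancel, mul_zero]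
  linarith

/-! ### Contraction of the error of the `q`-functions -/

/-- The error of a `q`-function, whose target moves with the opponent's policy, before the new
action is played. -/
theorem sqNorm_error_update_le [Nonempty B] {τ N β t : ℝ} (hτ : 0 < τ) (hN0 : 0 < N) (hβ : 0 ≤ β)
    (ht : 0 < t) (hA : (Fintype.card A : ℝ) ≤ N) (hB : (Fintype.card B : ℝ) ≤ N)
    {R : Matrix A B ℝ} (hR : ∀ a b, |R a b| ≤ 1) (q : A → ℝ) {p q' u : B → ℝ}
    (hp : p ∈ stdSimplex ℝ B) :
    sqNorm (q - R *ᵥ (p + β • (softmax τ q' - p)))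
      ≤ (1 + β * (N / τ + t)) * sqNorm (q - R *ᵥ p) + β * (N / τ) * sqNorm (q' - u)
        + β * (N ^ 2 / t) * sqNorm (softmax τ u - p) + β ^ 2 * N ^ 3 := by
  set e := q - R *ᵥ p with he
  set d := softmax τ q' - p with hd
  set w := softmax τ q' - softmax τ u with hw
  set z := softmax τ u - p with hz
  have h1 : q - R *ᵥ (p + β • d) = e - β • (R *ᵥ d) := by
    rw [mulVec_add, mulVec_smul, he]; abel
  have h2 : sqNorm (e - β • (R *ᵥ d))
      = sqNorm e + 2 * β * ((-e) ⬝ᵥ (R *ᵥ w)) + 2 * β * ((-e) ⬝ᵥ (R *ᵥ z))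
        + β ^ 2 * sqNorm (R *ᵥ d) := by
    have : d = w + z := by rw [hd, hw, hz]; abel
    rw [this]
    simp only [sqNorm, mulVec_add, dotProduct_sub, sub_dotProduct, dotProduct_smul, smul_dotProduct,
      smul_eq_mul, neg_dotProduct, dotProduct_add, add_dotProduct, smul_add]
    rw [dotProduct_comm (R *ᵥ w) e, dotProduct_comm (R *ᵥ z) e]
    ring
  have y1 := dotProduct_le_young (t := N / (2 * τ)) (by positivity) (-e) (R *ᵥ w)
  have y2 := dotProduct_le_young (t := t / 2) (by positivity) (-e) (R *ᵥ z)
  rw [sqNorm_neg] at y1 y2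
  have b1 : sqNorm (R *ᵥ w) ≤ N ^ 2 * (sqNorm (q' - u) / τ ^ 2) :=
    (sqNorm_mulVec_le hR hA hB w).trans (by gcongr; exact sqNorm_softmax_sub_le hτ q' u)
  have b2 := sqNorm_mulVec_le hR hA hB z
  have b3 : sqNorm (R *ᵥ d) ≤ N ^ 3 := by
    have h := (sqNorm_le_card (abs_sub_le_one hp (softmax_mem τ q'))).trans hB
    calc _ ≤ N ^ 2 * sqNorm d := sqNorm_mulVec_le hR hA hB d
      _ ≤ N ^ 2 * N := by gcongr
      _ = _ := by ring
  have y1' : 2 * ((-e) ⬝ᵥ (R *ᵥ w)) ≤ N / τ * sqNorm e + N / τ * sqNorm (q' - u) := by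
    calc 2 * ((-e) ⬝ᵥ (R *ᵥ w)) ≤ 2 * (N / (2 * τ) * sqNorm e
          + 1 / (4 * (N / (2 * τ))) * (N ^ 2 * (sqNorm (q' - u) / τ ^ 2))) := by
          refine mul_le_mul_of_nonneg_left (y1.trans ?_) zero_le_two
          gcongr
      _ = _ := by field_simp; ring
  have y2' : 2 * ((-e) ⬝ᵥ (R *ᵥ z)) ≤ t * sqNorm e + N ^ 2 / t * sqNorm z := by
    calc 2 * ((-e) ⬝ᵥ (R *ᵥ z)) ≤ 2 * (t / 2 * sqNorm e
          + 1 / (4 * (t / 2)) * (N ^ 2 * sqNorm z)) := by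
          refine mul_le_mul_of_nonneg_left (y2.trans ?_) zero_le_two
          gcongr
      _ = _ := by field_simp; ring
  rw [h1, h2]
  have m1 := mul_le_mul_of_nonneg_left y1' hβ
  have m2 := mul_le_mul_of_nonneg_left y2' hβ
  have m3 := mul_le_mul_of_nonneg_left b3 (sq_nonneg β)
  linarith

/-- The expected squared error after the sampled update of a `q`-function: the update of each
coordinate is centred at the mean payoff, and every action has probability at least `l`. -/
theorem expected_sqNorm_error_le [DecidableEq A] {l α : ℝ} (hα : 0 ≤ α)
    {R : Matrix A B ℝ} (hR : ∀ a b, |R a b| ≤ 1) {p : A → ℝ} {r : B → ℝ} {q : A → ℝ}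
    (hp : p ∈ stdSimplex ℝ A) (hr : r ∈ stdSimplex ℝ B) (hpl : ∀ a, l ≤ p a) (hq : ∀ a, |q a| ≤ 1) :
    ∑ a, ∑ b, p a * r b *
        sqNorm ((fun a' => q a' + α * (if a' = a then R a b - q a else 0)) - R *ᵥ r)
      ≤ (1 - 2 * α * l) * sqNorm (q - R *ᵥ r) + 4 * α ^ 2 := by
  set y := q - R *ᵥ r with hy
  have expand : ∀ a b,
      sqNorm ((fun a' => q a' + α * (if a' = a then R a b - q a else 0)) - R *ᵥ r)
        = sqNorm y + 2 * α * y a * (R a b - q a) + α ^ 2 * (R a b - q a) ^ 2 := by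
    intro a b
    have : ((fun a' => q a' + α * (if a' = a then R a b - q a else 0)) - R *ᵥ r)
        = y + Pi.single a (α * (R a b - q a)) := by
      ext a'
      by_cases h : a' = a
      · subst h; simp [hy]; ring
      · simp [hy, h]
    rw [this]
    simp only [sqNorm, dotProduct_add, add_dotProduct, dotProduct_single, single_dotProduct,
      Pi.add_apply, Pi.single_eq_same]
    ring
  have bound : ∀ a b, (R a b - q a) ^ 2 ≤ 4 := by
    intro a b
    have h1 := abs_le.1 (hR a b)
    have h2 := abs_le.1 (hq a)
    nlinarith
  have inner : ∀ a, ∑ b, p a * r b *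
      sqNorm ((fun a' => q a' + α * (if a' = a then R a b - q a else 0)) - R *ᵥ r)
        ≤ p a * (sqNorm y - 2 * α * y a ^ 2 + 4 * α ^ 2) := by
    intro a
    have mean : ∑ b, r b * (R a b - q a) = -y a := by
      have h1 : ∑ b, r b * (R a b - q a) = ∑ b, R a b * r b - (∑ b, r b) * q a := by
        rw [Finset.sum_mul, ← Finset.sum_sub_distrib]
        exact Finset.sum_congr rfl fun b _ => by ring
      rw [h1, hr.2, hy, Pi.sub_apply, mulVec, dotProduct]
      ring
    calc _ ≤ ∑ b, (p a * ((sqNorm y + 4 * α ^ 2) * r b + 2 * α * y a * (r b * (R a b - q a)))) := by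
          refine Finset.sum_le_sum fun b _ => ?_
          rw [expand]
          have h := mul_le_mul_of_nonneg_left (bound a b)
            (mul_nonneg (mul_nonneg (hp.1 a) (hr.1 b)) (sq_nonneg α))
          linarith
      _ = _ := by
          rw [← Finset.mul_sum, Finset.sum_add_distrib, ← Finset.mul_sum, ← Finset.mul_sum, mean,
            hr.2]
          ring
  have weight : l * sqNorm y ≤ ∑ a, p a * y a ^ 2 := by
    rw [sqNorm_eq, Finset.mul_sum]
    exact Finset.sum_le_sum fun a _ => mul_le_mul_of_nonneg_right (hpl a) (sq_nonneg _)
  calc _ ≤ ∑ a, p a * (sqNorm y - 2 * α * y a ^ 2 + 4 * α ^ 2) :=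
        Finset.sum_le_sum fun a _ => inner a
    _ = sqNorm y + 4 * α ^ 2 - 2 * α * ∑ a, p a * y a ^ 2 := by
        have h : ∀ a, p a * (sqNorm y - 2 * α * y a ^ 2 + 4 * α ^ 2)
            = p a * (sqNorm y + 4 * α ^ 2) - 2 * α * (p a * y a ^ 2) := fun a => by ring
        rw [Finset.sum_congr rfl fun a _ => h a, Finset.sum_sub_distrib, ← Finset.sum_mul,
          ← Finset.mul_sum, hp.2, one_mul]
    _ ≤ _ := by
        have := mul_le_mul_of_nonneg_left weight (by positivity : 0 ≤ 2 * α)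
        linarith

end

section

variable {A B : Type*} [Fintype A] [Fintype B]

/-! ### The states reached by the dynamics -/

theorem ell_pos {τ : ℝ} {Amax : ℕ} (hA : 1 ≤ Amax) : 0 < ell τ Amax := by
  have h : (1 : ℝ) ≤ Amax := by exact_mod_cast hA
  have := mul_nonneg (sub_nonneg.2 h) (Real.exp_pos (2 / τ)).le
  exact inv_pos.2 (by linarith)

theorem ell_mul_le_one {τ : ℝ} (hτ : 0 < τ) {Amax : ℕ} (hA : 1 ≤ Amax) :
    ell τ Amax * Amax ≤ 1 := by
  have h : (1 : ℝ) ≤ Amax := by exact_mod_cast hA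
  have h1 : 1 ≤ Real.exp (2 / τ) := Real.one_le_exp (by positivity)
  have h2 := mul_le_mul_of_nonneg_left h1 (sub_nonneg.2 h)
  rw [ell, inv_mul_le_iff₀ (by linarith)]
  linarith

theorem ell_le_softmax [Nonempty A] {τ : ℝ} (hτ : 0 < τ) {Amax : ℕ} (hA : Fintype.card A ≤ Amax)
    {u : A → ℝ} (hu : ∀ a, |u a| ≤ 1) (a : A) : ell τ Amax ≤ softmax τ u a := by
  classical
  have hA1 : (1 : ℝ) ≤ Fintype.card A := by exact_mod_cast Fintype.card_pos (α := A)
  have hA' : (Fintype.card A : ℝ) ≤ Amax := by exact_mod_cast hA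
  have he := Real.exp_pos (2 / τ)
  have hx := Real.exp_pos (u a / τ)
  have each : ∀ b, Real.exp (u b / τ) ≤ Real.exp (u a / τ) * Real.exp (2 / τ) := by
    intro b
    rw [← Real.exp_add, ← add_div]
    refine Real.exp_le_exp.2 (div_le_div_of_nonneg_right ?_ hτ.le)
    linarith [(abs_le.1 (hu a)).1, (abs_le.1 (hu b)).2]
  have hsum : ∑ b, Real.exp (u b / τ)
      ≤ Real.exp (u a / τ) * (1 + ((Amax : ℝ) - 1) * Real.exp (2 / τ)) := by
    rw [← Finset.add_sum_erase _ _ (Finset.mem_univ a)]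
    have h1 : ∑ b ∈ Finset.univ.erase a, Real.exp (u b / τ)
        ≤ ((Fintype.card A : ℝ) - 1) * (Real.exp (u a / τ) * Real.exp (2 / τ)) := by
      calc _ ≤ ∑ _b ∈ Finset.univ.erase a, Real.exp (u a / τ) * Real.exp (2 / τ) :=
            Finset.sum_le_sum fun b _ => each b
        _ = _ := by
          rw [Finset.sum_const, Finset.card_erase_of_mem (Finset.mem_univ a), Finset.card_univ,
            nsmul_eq_mul, Nat.cast_sub Fintype.card_pos, Nat.cast_one]
    have h2 : ((Fintype.card A : ℝ) - 1) * (Real.exp (u a / τ) * Real.exp (2 / τ))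
        ≤ ((Amax : ℝ) - 1) * (Real.exp (u a / τ) * Real.exp (2 / τ)) := by gcongr
    linarith
  have hD : 0 < 1 + ((Amax : ℝ) - 1) * Real.exp (2 / τ) := by
    have := mul_nonneg (sub_nonneg.2 (hA1.trans hA')) he.le
    linarith
  rw [ell, softmax, inv_eq_one_div, div_le_div_iff₀ hD (sum_exp_pos τ u)]
  linarith

/-- The invariants of the dynamics for one player: the policy is a mixed strategy giving every
action probability at least `l`, and the `q`-function takes values in `[-1, 1]`. -/
structure Player.IsAdmissible (l : ℝ) (s : Player A) : Prop where
  policy_mem : s.policy ∈ stdSimplex ℝ A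
  le_policy : ∀ a, l ≤ s.policy a
  abs_q_le : ∀ a, |s.q a| ≤ 1

theorem init_isAdmissible [Nonempty A] {τ : ℝ} (hτ : 0 < τ) {Amax : ℕ}
    (hA : Fintype.card A ≤ Amax) : (Player.init A).IsAdmissible (ell τ Amax) where
  policy_mem := init_mem
  le_policy a := by
    have hA0 : 1 ≤ Fintype.card A := Fintype.card_pos
    have hA1 : (0 : ℝ) < Fintype.card A := by exact_mod_cast hA0
    have hA' : (Fintype.card A : ℝ) ≤ Amax := by exact_mod_cast hA
    have h := ell_mul_le_one hτ (hA0.trans hA)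
    have := mul_le_mul_of_nonneg_left hA' (ell_pos (τ := τ) (hA0.trans hA)).le
    simp only [Player.init]
    rw [le_div_iff₀ hA1]
    linarith
  abs_q_le a := by simp [Player.init]

theorem nextPolicy_eq (τ β : ℝ) (s : Player A) :
    s.nextPolicy τ β = s.policy + β • (softmax τ s.q - s.policy) := rfl

theorem Player.IsAdmissible.le_nextPolicy [Nonempty A] {τ : ℝ} (hτ : 0 < τ) {Amax : ℕ}
    (hA : Fintype.card A ≤ Amax) {β : ℝ} (h0 : 0 ≤ β) (h1 : β ≤ 1) {s : Player A}
    (hs : s.IsAdmissible (ell τ Amax)) (a : A) : ell τ Amax ≤ s.nextPolicy τ β a := by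
  have e1 := mul_le_mul_of_nonneg_left (hs.le_policy a) (sub_nonneg.2 h1)
  have e2 := mul_le_mul_of_nonneg_left (ell_le_softmax hτ hA hs.abs_q_le a) h0
  simp only [Player.nextPolicy]
  linarith

theorem Player.IsAdmissible.step [Nonempty A] [DecidableEq A] {τ : ℝ} (hτ : 0 < τ) {Amax : ℕ}
    (hA : Fintype.card A ≤ Amax) {α β : ℝ} (hα0 : 0 ≤ α) (hα1 : α ≤ 1) (h0 : 0 ≤ β) (h1 : β ≤ 1)
    {s : Player A} (hs : s.IsAdmissible (ell τ Amax)) (a : A) {r : ℝ} (hr : |r| ≤ 1) :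
    (s.step τ α β a r).IsAdmissible (ell τ Amax) where
  policy_mem := nextPolicy_mem h0 h1 hs.policy_mem
  le_policy := hs.le_nextPolicy hτ hA h0 h1
  abs_q_le a' := by
    simp only [Player.step]
    split_ifs with h
    · subst h
      have h1 := abs_le.1 hr
      have h2 := abs_le.1 (hs.abs_q_le a')
      rw [abs_le]
      constructor <;> nlinarith
    · simpa using hs.abs_q_le a'

variable [DecidableEq A] [DecidableEq B]

theorem state_isAdmissible [Nonempty A] [Nonempty B] {τ : ℝ} (hτ : 0 < τ) {Amax : ℕ}
    (hA : Fintype.card A ≤ Amax) (hB : Fintype.card B ≤ Amax) {R : Matrix A B ℝ}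
    (hR : ∀ a b, |R a b| ≤ 1) {α β : ℕ → ℝ} (hα : ∀ k, 0 ≤ α k ∧ α k ≤ 1)
    (hβ : ∀ k, 0 ≤ β k ∧ β k ≤ 1) :
    ∀ (k : ℕ) (hist : Fin k → A × B),
      (state R τ α β k hist).1.IsAdmissible (ell τ Amax) ∧
        (state R τ α β k hist).2.IsAdmissible (ell τ Amax)
  | 0, _ => ⟨init_isAdmissible hτ hA, init_isAdmissible hτ hB⟩
  | k + 1, hist =>
    have h := state_isAdmissible hτ hA hB hR hα hβ k (Fin.init hist)
    ⟨h.1.step hτ hA (hα k).1 (hα k).2 (hβ k).1 (hβ k).2 _ (hR _ _),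
      h.2.step hτ hB (hα k).1 (hα k).2 (hβ k).1 (hβ k).2 _ (abs_neg_transpose_le hR _ _)⟩

/-- The expectation of a function of the state after `k` iterations. -/
def expect (R : Matrix A B ℝ) (τ : ℝ) (α β : ℕ → ℝ) (k : ℕ) (f : Player A → Player B → ℝ) : ℝ :=
  ∑ hist : Fin k → A × B, prob R τ α β k hist *
    f (state R τ α β k hist).1 (state R τ α β k hist).2

/-- The conditional expectation of a function of the next state, given the current one. -/
def expectStep (R : Matrix A B ℝ) (τ α β : ℝ) (f : Player A → Player B → ℝ)
    (s₁ : Player A) (s₂ : Player B) : ℝ :=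
  ∑ a, ∑ b, s₁.nextPolicy τ β a * s₂.nextPolicy τ β b *
    f (s₁.step τ α β a (R a b)) (s₂.step τ α β b ((-Rᵀ) b a))

theorem expect_succ (R : Matrix A B ℝ) (τ : ℝ) (α β : ℕ → ℝ) (k : ℕ)
    (f : Player A → Player B → ℝ) :
    expect R τ α β (k + 1) f = expect R τ α β k (expectStep R τ (α k) (β k) f) := by
  rw [expect, expect, ← (Fin.snocEquiv (fun _ => A × B)).sum_comp, Fintype.sum_prod_type_right]
  refine Finset.sum_congr rfl fun hist _ => ?_
  simp only [Fin.snocEquiv, Equiv.coe_fn_mk, prob, state, Fin.init_snoc, Fin.snoc_last]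
  rw [expectStep, Finset.mul_sum, Fintype.sum_prod_type]
  refine Finset.sum_congr rfl fun a _ => ?_
  rw [Finset.mul_sum]
  exact Finset.sum_congr rfl fun b _ => by ring

section Expectation

variable [Nonempty A] [Nonempty B] {R : Matrix A B ℝ} {τ : ℝ} {α β : ℕ → ℝ} {k : ℕ}

theorem expect_mono (hβ : ∀ k, 0 ≤ β k ∧ β k ≤ 1) {f g : Player A → Player B → ℝ}
    (h : ∀ hist, f (state R τ α β k hist).1 (state R τ α β k hist).2
      ≤ g (state R τ α β k hist).1 (state R τ α β k hist).2) :
    expect R τ α β k f ≤ expect R τ α β k g :=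
  Finset.sum_le_sum fun hist _ =>
    mul_le_mul_of_nonneg_left (h hist) (prob_nonneg R τ α β hβ k hist)

theorem expect_affine (hβ : ∀ k, 0 ≤ β k ∧ β k ≤ 1) (x y : ℝ) (f : Player A → Player B → ℝ) :
    expect R τ α β k (fun s₁ s₂ => x * f s₁ s₂ + y) = x * expect R τ α β k f + y := by
  have h := sum_prob R τ α β hβ k
  simp only [expect]
  rw [Finset.mul_sum]
  calc _ = ∑ hist : Fin k → A × B, (x * (prob R τ α β k hist *
        f (state R τ α β k hist).1 (state R τ α β k hist).2) + prob R τ α β k hist * y) :=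
        Finset.sum_congr rfl fun hist _ => by ring
    _ = _ := by rw [Finset.sum_add_distrib, ← Finset.sum_mul, h, one_mul]

end Expectation

/-! ### The Lyapunov function -/

/-- The sum over the players of the squared distance between the `q`-function and the payoff vector
it estimates. -/
def qError (R : Matrix A B ℝ) (s₁ : Player A) (s₂ : Player B) : ℝ :=
  sqNorm (s₁.q - R *ᵥ s₂.policy) + sqNorm (s₂.q - (-Rᵀ) *ᵥ s₁.policy)

/-- The Lyapunov function: the regularized gap of the policies plus a multiple of the error of the
`q`-functions. -/
def lyapunov (τ lam : ℝ) (R : Matrix A B ℝ) (s₁ : Player A) (s₂ : Player B) : ℝ :=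
  regGap τ R s₁.policy s₂.policy + lam * qError R s₁ s₂

theorem qError_nonneg {A B : Type*} [Fintype A] [Fintype B] (R : Matrix A B ℝ) (s₁ : Player A)
    (s₂ : Player B) : 0 ≤ qError R s₁ s₂ :=
  add_nonneg (sqNorm_nonneg _) (sqNorm_nonneg _)

theorem expectStep_qError_le [Nonempty A] [Nonempty B] {τ : ℝ} (hτ : 0 < τ) {Amax : ℕ}
    (hA : Fintype.card A ≤ Amax) (hB : Fintype.card B ≤ Amax) {R : Matrix A B ℝ}
    (hR : ∀ a b, |R a b| ≤ 1) {α β : ℝ} (hα : 0 ≤ α) (hβ0 : 0 ≤ β) (hβ1 : β ≤ 1)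
    {s₁ : Player A} {s₂ : Player B} (h₁ : s₁.IsAdmissible (ell τ Amax))
    (h₂ : s₂.IsAdmissible (ell τ Amax)) :
    expectStep R τ α β (qError R) s₁ s₂
      ≤ (1 - 2 * α * ell τ Amax) * (sqNorm (s₁.q - R *ᵥ s₂.nextPolicy τ β)
          + sqNorm (s₂.q - (-Rᵀ) *ᵥ s₁.nextPolicy τ β)) + 8 * α ^ 2 := by
  have m₁ := nextPolicy_mem (τ := τ) hβ0 hβ1 h₁.policy_mem
  have m₂ := nextPolicy_mem (τ := τ) hβ0 hβ1 h₂.policy_mem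
  have e₁ := expected_sqNorm_error_le hα hR m₁ m₂ (h₁.le_nextPolicy hτ hA hβ0 hβ1) h₁.abs_q_le
  have e₂ := expected_sqNorm_error_le hα (abs_neg_transpose_le hR) m₂ m₁
    (h₂.le_nextPolicy hτ hB hβ0 hβ1) h₂.abs_q_le
  rw [Finset.sum_comm] at e₂
  have split : expectStep R τ α β (qError R) s₁ s₂
      = (∑ a, ∑ b, s₁.nextPolicy τ β a * s₂.nextPolicy τ β b *
          sqNorm ((fun a' => s₁.q a' + α * (if a' = a then R a b - s₁.q a else 0))
            - R *ᵥ s₂.nextPolicy τ β))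
        + ∑ a, ∑ b, s₂.nextPolicy τ β b * s₁.nextPolicy τ β a *
          sqNorm ((fun b' => s₂.q b' + α * (if b' = b then (-Rᵀ) b a - s₂.q b else 0))
            - (-Rᵀ) *ᵥ s₁.nextPolicy τ β) := by
    rw [expectStep, ← Finset.sum_add_distrib]
    refine Finset.sum_congr rfl fun a _ => ?_
    rw [← Finset.sum_add_distrib]
    refine Finset.sum_congr rfl fun b _ => ?_
    simp only [qError, Player.step]
    ring
  rw [split]
  linarith

theorem expectStep_lyapunov_eq [Nonempty A] [Nonempty B] {τ lam α β : ℝ} (hβ0 : 0 ≤ β)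
    (hβ1 : β ≤ 1) (R : Matrix A B ℝ) {s₁ : Player A} {s₂ : Player B}
    (h₁ : s₁.policy ∈ stdSimplex ℝ A) (h₂ : s₂.policy ∈ stdSimplex ℝ B) :
    expectStep R τ α β (lyapunov τ lam R) s₁ s₂
      = regGap τ R (s₁.nextPolicy τ β) (s₂.nextPolicy τ β)
        + lam * expectStep R τ α β (qError R) s₁ s₂ := by
  have m₁ := (nextPolicy_mem (τ := τ) hβ0 hβ1 h₁).2
  have m₂ := (nextPolicy_mem (τ := τ) hβ0 hβ1 h₂).2
  set V := regGap τ R (s₁.nextPolicy τ β) (s₂.nextPolicy τ β) with hV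
  have one : ∑ a, ∑ b, s₁.nextPolicy τ β a * s₂.nextPolicy τ β b = 1 := by
    rw [← Finset.sum_mul_sum, m₁, m₂, one_mul]
  rw [expectStep, expectStep, Finset.mul_sum, ← one_mul V, ← one, Finset.sum_mul,
    ← Finset.sum_add_distrib]
  refine Finset.sum_congr rfl fun a _ => ?_
  rw [Finset.mul_sum, Finset.sum_mul, ← Finset.sum_add_distrib]
  refine Finset.sum_congr rfl fun b _ => ?_
  rw [lyapunov, hV]
  simp only [Player.step]
  ring

/-- The expected decrease of the Lyapunov function in one iteration. The weight `lam` and the Young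
parameter `t` have to balance two couplings: the error of the `q`-functions slows the decrease of
the regularized gap (`hW`), and the motion of the policies disturbs the `q`-functions (`hS`). -/
theorem expectStep_lyapunov_le [Nonempty A] [Nonempty B] {τ lam t c : ℝ} (hτ : 0 < τ)
    (hlam : 0 < lam) (ht : 0 < t) {Amax : ℕ} (hA : Fintype.card A ≤ Amax)
    (hB : Fintype.card B ≤ Amax) (hAmax : 2 ≤ Amax) {R : Matrix A B ℝ}
    (hR : ∀ a b, |R a b| ≤ 1) (hc0 : 0 ≤ c) (hc1 : c ≤ 1)
    (hS : lam * ((Amax : ℝ) ^ 2 / t) ≤ 3 * τ / 8)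
    (hW : c * (4 * (Amax : ℝ) ^ 2 / τ ^ 3 + 4 / (ell τ Amax ^ 2 * τ)
      + lam * (2 * (Amax / τ) + t + 1 / 2)) ≤ 2 * ell τ Amax * lam)
    {α : ℝ} (hα0 : 0 ≤ α) (hα1 : α ≤ 1)
    {s₁ : Player A} {s₂ : Player B} (h₁ : s₁.IsAdmissible (ell τ Amax))
    (h₂ : s₂.IsAdmissible (ell τ Amax)) :
    expectStep R τ α (c * α) (lyapunov τ lam R) s₁ s₂
      ≤ (1 - c * α / 2) * lyapunov τ lam R s₁ s₂
        + (2 * ((Amax : ℝ) ^ 3 / τ + τ * Amax / ell τ Amax)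
          + lam * (2 * (Amax : ℝ) ^ 3 + 8)) * α ^ 2 := by
  have hA' : (Fintype.card A : ℝ) ≤ Amax := by exact_mod_cast hA
  have hB' : (Fintype.card B : ℝ) ≤ Amax := by exact_mod_cast hB
  have hN2 : (2 : ℝ) ≤ Amax := by exact_mod_cast hAmax
  have hl := ell_pos (τ := τ) (Amax := Amax) (by omega)
  have hlN := ell_mul_le_one hτ (Amax := Amax) (by omega)
  have hR' := abs_neg_transpose_le hR
  set N : ℝ := (Amax : ℝ)
  set l := ell τ Amax
  set β := c * α with hβ
  have hβ0 : 0 ≤ β := by positivity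
  have hβα : β ≤ α := mul_le_of_le_one_left hα0 hc1
  have hβ1 : β ≤ 1 := hβα.trans hα1
  have hV := regGap_update_le (τ := τ) (q₁ := s₁.q) (q₂ := s₂.q) hτ hl hβ0 hA' hB' hR
    h₁.policy_mem h₂.policy_mem h₁.le_policy h₂.le_policy
    (ell_le_softmax hτ hA (abs_mulVec_le hR h₂.policy_mem))
    (ell_le_softmax hτ hB (abs_mulVec_le hR' h₁.policy_mem))
    (h₁.le_nextPolicy hτ hA hβ0 hβ1) (h₂.le_nextPolicy hτ hB hβ0 hβ1)
  have hY₁ := sqNorm_error_update_le (u := (-Rᵀ) *ᵥ s₁.policy) (q' := s₂.q) hτ (by linarith) hβ0 ht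
    hA' hB' hR s₁.q h₂.policy_mem
  have hY₂ := sqNorm_error_update_le (u := R *ᵥ s₂.policy) (q' := s₁.q) hτ (by linarith) hβ0 ht
    hB' hA' hR' s₂.q h₁.policy_mem
  have hQ := expectStep_qError_le hτ hA hB hR hα0 hβ0 hβ1 h₁ h₂
  rw [expectStep_lyapunov_eq hβ0 hβ1 R h₁.policy_mem h₂.policy_mem, lyapunov]
  simp only [← nextPolicy_eq] at hV hY₁ hY₂
  set Y := sqNorm (s₁.q - R *ᵥ s₂.nextPolicy τ β) + sqNorm (s₂.q - (-Rᵀ) *ᵥ s₁.nextPolicy τ β)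
    with hYdef
  set S := sqNorm (softmax τ (R *ᵥ s₂.policy) - s₁.policy)
    + sqNorm (softmax τ ((-Rᵀ) *ᵥ s₁.policy) - s₂.policy) with hSdef
  set W := qError R s₁ s₂ with hWdef
  have hWe : sqNorm (s₁.q - R *ᵥ s₂.policy) + sqNorm (s₂.q - (-Rᵀ) *ᵥ s₁.policy) = W := rfl
  rw [hWe] at hV
  have hS0 : 0 ≤ S := add_nonneg (sqNorm_nonneg _) (sqNorm_nonneg _)
  have hW0 : 0 ≤ W := qError_nonneg R s₁ s₂
  set X := 2 * (N / τ) + t with hX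
  have hX0 : 0 ≤ X := by positivity
  have hY : Y ≤ (1 + β * X) * W + β * (N ^ 2 / t) * S + 2 * β ^ 2 * N ^ 3 := by
    rw [← hWe]
    linarith
  have hκ0 : 0 ≤ 1 - 2 * α * l := by nlinarith
  have hκ : 0 ≤ 2 * α * l := by positivity
  have hQ2 : (1 - 2 * α * l) * Y
      ≤ (1 - 2 * α * l + β * X) * W + β * (N ^ 2 / t) * S + 2 * α ^ 2 * N ^ 3 := by
    have e1 := mul_le_mul_of_nonneg_left hY hκ0
    have e2 : 0 ≤ 2 * α * l * (β * X * W + β * (N ^ 2 / t) * S + 2 * β ^ 2 * N ^ 3) := by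
      positivity
    have e3 : 2 * β ^ 2 * N ^ 3 ≤ 2 * α ^ 2 * N ^ 3 := by gcongr
    linarith
  have q1 := mul_le_mul_of_nonneg_left (hQ.trans (add_le_add_left hQ2 _)) hlam.le
  have q2 := mul_le_mul_of_nonneg_right hS (mul_nonneg hβ0 hS0)
  have q3 := mul_le_mul_of_nonneg_right hW (mul_nonneg hα0 hW0)
  have q4 : β ^ 2 * (2 * (N ^ 3 / τ + τ * N / l)) ≤ α ^ 2 * (2 * (N ^ 3 / τ + τ * N / l)) := by
    gcongr
  set M := 4 * N ^ 2 / τ ^ 3 + 4 / (l ^ 2 * τ)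
  set L := 2 * (N ^ 3 / τ + τ * N / l)
  set T := N ^ 2 / t
  have q3' : β * M * W + lam * (β * X * W) + lam * (β / 2 * W) ≤ lam * (2 * α * l * W) := by
    rw [hβ]; linarith
  linarith

/-- The weights `lam = 1 / (l τ N)` and `t = 4 N / (l τ²)` balance the Lyapunov function for
temperatures at most `3 / 2`: after multiplication by `l² τ³` every term in the bracket is bounded
by an absolute constant. -/
theorem weights_balance {τ l N c : ℝ} (hτ : 0 < τ) (hτ2 : τ ≤ 3 / 2) (hl : 0 < l) (hN : 2 ≤ N)
    (hlN : l * N ≤ 1) (hc : c ≤ l ^ 3 * τ ^ 3 / (100 * N ^ 2)) :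
    c * (4 * N ^ 2 / τ ^ 3 + 4 / (l ^ 2 * τ)
      + 1 / (l * τ * N) * (2 * (N / τ) + 4 * N / (l * τ ^ 2) + 1 / 2)) ≤
        2 * l * (1 / (l * τ * N)) := by
  have hl1 : l ≤ 1 / 2 := by nlinarith
  have hN0 : 0 < N := by linarith
  have hlτ : l * τ ≤ 3 / 4 := by nlinarith
  have e : 4 * N ^ 2 / τ ^ 3 + 4 / (l ^ 2 * τ)
      + 1 / (l * τ * N) * (2 * (N / τ) + 4 * N / (l * τ ^ 2) + 1 / 2)
      = (4 * (l * N) ^ 2 + 4 * τ ^ 2 + 2 * (l * τ) + 4 + l * τ * τ / (2 * N)) / (l ^ 2 * τ ^ 3) := by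
    field_simp
    ring
  have b1 : (l * N) ^ 2 ≤ 1 := pow_le_one₀ (by positivity) hlN
  have b2 : τ ^ 2 ≤ 9 / 4 := by nlinarith
  have b3 : l * τ * τ / (2 * N) ≤ 3 := by
    rw [div_le_iff₀ (by positivity)]
    nlinarith [mul_le_mul_of_nonneg_right hlτ hτ.le]
  have b : (4 * (l * N) ^ 2 + 4 * τ ^ 2 + 2 * (l * τ) + 4 + l * τ * τ / (2 * N)) / (l ^ 2 * τ ^ 3)
      ≤ 22 / (l ^ 2 * τ ^ 3) := by
    gcongr
    linarith
  rw [e]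
  calc _ ≤ l ^ 3 * τ ^ 3 / (100 * N ^ 2) * (22 / (l ^ 2 * τ ^ 3)) := by
        refine mul_le_mul hc b ?_ (by positivity)
        positivity
    _ = (11 * (l * τ)) / (50 * N) * (1 / (τ * N)) := by field_simp; ring
    _ ≤ 2 * (1 / (τ * N)) := by
        gcongr
        rw [div_le_iff₀ (by positivity)]
        linarith
    _ = _ := by field_simp

/-- A recursion with contraction `a / n` and noise of order `1 / n ^ 2` has rate `1 / n`
when `a > 1`. -/
theorem le_div_of_recursion {u : ℕ → ℝ} {a b h D : ℝ} (ha : 1 < a) (hah : a < h)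
    (hu0 : u 0 ≤ D / h) (hD : b ≤ (a - 1) * D) (hD0 : 0 ≤ D)
    (hu : ∀ k : ℕ, u (k + 1) ≤ (1 - a / ((k : ℝ) + h)) * u k + b / ((k : ℝ) + h) ^ 2) (k : ℕ) :
    u k ≤ D / ((k : ℝ) + h) := by
  induction k with
  | zero => simpa using hu0
  | succ k ih =>
    have hk : (0 : ℝ) ≤ k := Nat.cast_nonneg k
    set n : ℝ := (k : ℝ) + h with hn
    have hn0 : 0 < n := by linarith
    have han : 0 ≤ 1 - a / n := by
      rw [sub_nonneg, div_le_one hn0]; linarith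
    have hn1 : ((k + 1 : ℕ) : ℝ) + h = n + 1 := by push_cast; ring
    rw [hn1]
    calc u (k + 1) ≤ (1 - a / n) * (D / n) + (a - 1) * D / n ^ 2 := by
          refine (hu k).trans ?_
          gcongr
      _ = D * ((n - 1) / n ^ 2) := by field_simp; ring
      _ ≤ D * (1 / (n + 1)) := by
          refine mul_le_mul_of_nonneg_left ?_ hD0
          rw [div_le_div_iff₀ (by positivity) (by positivity)]
          linarith
      _ = _ := by ring

theorem expectedNashGap_le_of_forall [Nonempty A] [Nonempty B] {R : Matrix A B ℝ} {τ m : ℝ}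
    {α β : ℕ → ℝ} (hβ : ∀ k, 0 ≤ β k ∧ β k ≤ 1) {k : ℕ}
    (h : ∀ p₁ ∈ stdSimplex ℝ A, ∀ p₂ ∈ stdSimplex ℝ B, nashGap R p₁ p₂ ≤ m) :
    expectedNashGap R τ α β k ≤ m := by
  -- the constant `m` is written as an affine function, so that `expect_affine` evaluates its mean
  have h1 := expect_mono (k := k) (R := R) (τ := τ) (α := α) hβ
    (f := fun s₁ s₂ => nashGap R s₁.policy s₂.policy) (g := fun _ _ => 0 * 0 + m) (fun hist => by
      have hs := state_mem R τ α β hβ k hist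
      simpa using h _ hs.1 _ hs.2)
  rw [expect_affine hβ 0 m (fun _ _ => 0)] at h1
  simpa [expect, expectedNashGap] using h1

theorem expectedNashGap_le_expect_lyapunov [Nonempty A] [Nonempty B] {τ lam : ℝ} (hτ : 0 < τ)
    (hlam : 0 ≤ lam) {Amax : ℕ} (hA : Fintype.card A ≤ Amax) (hB : Fintype.card B ≤ Amax)
    {R : Matrix A B ℝ} (hR : ∀ a b, |R a b| ≤ 1) {α β : ℕ → ℝ} (hα : ∀ k, 0 ≤ α k ∧ α k ≤ 1)
    (hβ : ∀ k, 0 ≤ β k ∧ β k ≤ 1) (k : ℕ) :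
    expectedNashGap R τ α β k
      ≤ expect R τ α β k (lyapunov τ lam R) + 2 * τ * Real.log Amax := by
  have hl : 0 < ell τ Amax := ell_pos (le_trans Fintype.card_pos hA)
  have h := expect_mono (k := k) (R := R) (τ := τ) (α := α) hβ
    (f := fun s₁ s₂ => nashGap R s₁.policy s₂.policy)
    (g := fun s₁ s₂ => 1 * lyapunov τ lam R s₁ s₂ + 2 * τ * Real.log Amax) (fun hist => by
      have hs := state_isAdmissible hτ hA hB hR hα hβ k hist
      have h1 := nashGap_le_regGap_add hτ (N := Amax) (by exact_mod_cast hA)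
        (by exact_mod_cast hB) R hs.1.policy_mem hs.2.policy_mem
        (fun a => hl.trans_le (hs.1.le_policy a)) (fun b => hl.trans_le (hs.2.le_policy b))
      have h2 := mul_nonneg hlam
        (qError_nonneg R (state R τ α β k hist).1 (state R τ α β k hist).2)
      simp only [lyapunov]
      linarith)
  rw [expect_affine hβ, one_mul] at h
  exact h

theorem sqNorm_init_error_le {A B : Type*} [Fintype A] [Fintype B] [Nonempty B] {N : ℝ}
    {R : Matrix A B ℝ} (hR : ∀ a b, |R a b| ≤ 1) (hA : (Fintype.card A : ℝ) ≤ N) :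
    sqNorm ((Player.init A).q - R *ᵥ (Player.init B).policy) ≤ N := by
  refine (sqNorm_le_card fun a => ?_).trans hA
  simpa [Player.init] using abs_mulVec_le hR (init_mem (A := B)) a

theorem expect_zero_lyapunov_le [Nonempty A] [Nonempty B] {τ lam : ℝ} (hτ : 0 < τ)
    (hlam : 0 ≤ lam) {N : ℝ} (hA : (Fintype.card A : ℝ) ≤ N) (hB : (Fintype.card B : ℝ) ≤ N)
    {R : Matrix A B ℝ} (hR : ∀ a b, |R a b| ≤ 1) (α β : ℕ → ℝ) :
    expect R τ α β 0 (lyapunov τ lam R) ≤ 2 + 2 * τ * Real.log N + lam * (2 * N) := by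
  have h1 := regGap_le hτ hA hB hR (init_mem (A := A)) (init_mem (A := B))
  have h2 := sqNorm_init_error_le hR hA
  have h3 := sqNorm_init_error_le (abs_neg_transpose_le hR) hB
  have h4 : qError R (Player.init A) (Player.init B) ≤ 2 * N := by
    rw [qError]; linarith
  have h5 := mul_le_mul_of_nonneg_left h4 hlam
  simp only [expect, prob, state, Finset.univ_unique, Finset.sum_singleton, one_mul, lyapunov]
  linarith

end

/-! ### The convergence rate -/

/-- The `1 / K` rate, for weights `lam` and `t` that balance the Lyapunov function. The condition
`2 / c < α` makes the contraction factor `1 - (c * α / 2) / (k + h)` strong enough for it. -/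
theorem expectedNashGap_le_div {A B : Type*} [Fintype A] [Fintype B] [DecidableEq A]
    [DecidableEq B] [Nonempty A] [Nonempty B] {τ lam t c α h D : ℝ} (hτ : 0 < τ)
    (hlam : 0 < lam) (ht : 0 < t) {Amax : ℕ} (hA : Fintype.card A ≤ Amax)
    (hB : Fintype.card B ≤ Amax) (hAmax : 2 ≤ Amax) {R : Matrix A B ℝ}
    (hR : ∀ a b, |R a b| ≤ 1) (hc0 : 0 < c) (hc1 : c < 1)
    (hS : lam * ((Amax : ℝ) ^ 2 / t) ≤ 3 * τ / 8)
    (hW : c * (4 * (Amax : ℝ) ^ 2 / τ ^ 3 + 4 / (ell τ Amax ^ 2 * τ)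
      + lam * (2 * (Amax / τ) + t + 1 / 2)) ≤ 2 * ell τ Amax * lam)
    (hα : 2 / c < α) (hh : α < h) (hD0 : 0 ≤ D)
    (hDinit : 2 + 2 * τ * Real.log Amax + lam * (2 * Amax) ≤ D / h)
    (hDnoise : (2 * ((Amax : ℝ) ^ 3 / τ + τ * Amax / ell τ Amax)
      + lam * (2 * (Amax : ℝ) ^ 3 + 8)) * α ^ 2 ≤ (c * α / 2 - 1) * D) (K : ℕ) :
    expectedNashGap R τ (fun k => α / ((k : ℝ) + h)) (fun k => c * (α / ((k : ℝ) + h))) K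
      ≤ D / ((K : ℝ) + h) + 2 * τ * Real.log Amax := by
  have hα0 : 0 < α := (by positivity : (0 : ℝ) < 2 / c).trans hα
  have hcα : 2 < c * α := by
    rw [div_lt_iff₀ hc0] at hα; linarith
  have hcαα : c * α ≤ α := mul_le_of_le_one_left hα0.le hc1.le
  have hstep : ∀ k : ℕ, 0 ≤ α / ((k : ℝ) + h) ∧ α / ((k : ℝ) + h) ≤ 1 := by
    intro k
    have hk : (0 : ℝ) ≤ k := Nat.cast_nonneg k
    have hn : 0 < (k : ℝ) + h := by linarith
    exact ⟨by positivity, (div_le_one hn).2 (by linarith)⟩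
  have hstep' : ∀ k : ℕ, 0 ≤ c * (α / ((k : ℝ) + h)) ∧ c * (α / ((k : ℝ) + h)) ≤ 1 := fun k =>
    ⟨mul_nonneg hc0.le (hstep k).1, mul_le_one₀ hc1.le (hstep k).1 (hstep k).2⟩
  have hgap := expectedNashGap_le_expect_lyapunov hτ hlam.le hA hB hR hstep hstep' K
  refine hgap.trans (add_le_add_left ?_ _)
  refine le_div_of_recursion (a := c * α / 2) (u := fun k => expect R τ _ _ k (lyapunov τ lam R))
    (by linarith) (by linarith) ?_ hDnoise hD0 (fun k => ?_) K
  · exact (expect_zero_lyapunov_le hτ hlam.le (by exact_mod_cast hA) (by exact_mod_cast hB) hR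
      _ _).trans hDinit
  · simp only [expect_succ]
    refine (expect_mono hstep' fun hist => ?_).trans (expect_affine hstep' _ _ _).le
    have hs := state_isAdmissible hτ hA hB hR hstep hstep' k hist
    have h1 := expectStep_lyapunov_le hτ hlam ht hA hB hAmax hR hc0.le hc1.le hS hW
      (hstep k).1 (hstep k).2 hs.1 hs.2
    refine h1.trans (le_of_eq ?_)
    rw [div_pow, mul_div_assoc _ (α ^ 2), ← mul_div_assoc c, div_right_comm (c * α)]

/-- At high temperatures the bias `2 τ log Amax` exceeds `2`, the largest possible Nash gap, and in a
game with a single joint action the Nash gap vanishes. -/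
theorem nashGap_le_of_high_temperature {A B : Type*} [Fintype A] [Fintype B] [Nonempty A]
    [Nonempty B] {τ : ℝ} {Amax : ℕ} (hA : Fintype.card A ≤ Amax) (hB : Fintype.card B ≤ Amax)
    (hAmax : 2 ≤ Amax → 3 / 2 < τ) {R : Matrix A B ℝ} (hR : ∀ a b, |R a b| ≤ 1)
    {p₁ : A → ℝ} (hp₁ : p₁ ∈ stdSimplex ℝ A) {p₂ : B → ℝ} (hp₂ : p₂ ∈ stdSimplex ℝ B) :
    nashGap R p₁ p₂ ≤ 2 * τ * Real.log Amax := by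
  rcases Nat.lt_or_ge Amax 2 with hlt | hge
  · have h1 : Amax = 1 := by
      have : 0 < Fintype.card A := Fintype.card_pos
      omega
    subst h1
    have : Subsingleton A := Fintype.card_le_one_iff_subsingleton.1 hA
    have : Subsingleton B := Fintype.card_le_one_iff_subsingleton.1 hB
    simpa using nashGap_le_zero_of_subsingleton R hp₁ hp₂
  · have hτ := hAmax hge
    have hN : (2 : ℝ) ≤ Amax := by exact_mod_cast hge
    have h1 := Real.log_le_log zero_lt_two hN
    have h2 := Real.log_two_gt_d9
    have h3 := nashGap_le_two hR hp₁ hp₂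
    nlinarith

end DSBR

end

theorem mainTheorem5 :
    ∃ c₀ : ℝ, 0 < c₀ ∧
      ∀ (Amax : ℕ) (τ c α h : ℝ), 0 < τ → 0 < c → c < 1 →
        c ≤ DSBR.ell τ Amax ^ 3 * τ ^ 3 / (c₀ * (Amax : ℝ) ^ 2) →
        2 / c < α → α < h →
        ∃ C : ℝ, 0 < C ∧
          ∀ (A B : Type*) [Fintype A] [Fintype B] [DecidableEq A] [DecidableEq B]
            [Nonempty A] [Nonempty B] (R : Matrix A B ℝ),
            max (Fintype.card A) (Fintype.card B) = Amax →
            (∀ a b, |R a b| ≤ 1) →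
            ∀ (ε : ℝ), 0 < ε → ∀ K : ℕ, C / ε ≤ (K : ℝ) →
              DSBR.expectedNashGap R τ (fun k => α / ((k : ℝ) + h))
                  (fun k => c * (α / ((k : ℝ) + h))) K
                ≤ ε + 2 * τ * Real.log (Amax : ℝ) := by
  refine ⟨100, by norm_num, ?_⟩
  intro Amax τ c α h hτ hc0 hc1 hc hα hh
  have hα0 : 0 < α := (by positivity : (0 : ℝ) < 2 / c).trans hα
  have hh0 : 0 < h := hα0.trans hh
  by_cases hcase : 2 ≤ Amax ∧ τ ≤ 3 / 2
  · obtain ⟨hAmax, hτ2⟩ := hcase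
    have hN : (2 : ℝ) ≤ Amax := by exact_mod_cast hAmax
    have hN0 : (0 : ℝ) < Amax := by linarith
    have hl := DSBR.ell_pos (τ := τ) (Amax := Amax) (by omega)
    have hlN := DSBR.ell_mul_le_one hτ (Amax := Amax) (by omega)
    have hbal := DSBR.weights_balance hτ hτ2 hl hN hlN hc
    set N : ℝ := (Amax : ℝ) with hNdef
    set l := DSBR.ell τ Amax
    -- `lam` and `t` are the weights balanced in `weights_balance`; `D` dominates both the initial
    -- value of the Lyapunov function and the accumulated noise.
    set lam := 1 / (l * τ * N) with hlam
    set t := 4 * N / (l * τ ^ 2) with ht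
    have hlam0 : 0 < lam := by positivity
    have ht0 : 0 < t := by positivity
    have hS : lam * (N ^ 2 / t) ≤ 3 * τ / 8 := by
      have e : lam * (N ^ 2 / t) = τ / 4 := by rw [hlam, ht]; field_simp
      rw [e]; linarith
    have hcα : 0 < c * α / 2 - 1 := by
      rw [div_lt_iff₀ hc0] at hα; linarith
    have hlog : 0 ≤ Real.log N := Real.log_nonneg (by linarith)
    set I := 2 + 2 * τ * Real.log N + lam * (2 * N) with hI
    set L := (2 * (N ^ 3 / τ + τ * N / l) + lam * (2 * N ^ 3 + 8)) * α ^ 2 with hL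
    have hI0 : 0 < I := by positivity
    have hL0 : 0 < L := by positivity
    set D := h * I + L / (c * α / 2 - 1) with hD
    have hD0 : 0 < D := by positivity
    have hDinit : I ≤ D / h := by
      have : 0 ≤ L / (c * α / 2 - 1) := by positivity
      rw [le_div_iff₀ hh0, hD]
      linarith
    have hDnoise : L ≤ (c * α / 2 - 1) * D := by
      have := mul_pos hcα (mul_pos hh0 hI0)
      rw [hD, mul_add, mul_div_cancel₀ _ hcα.ne']
      linarith
    refine ⟨D, hD0, ?_⟩
    intro A B _ _ _ _ _ _ R hcard hR ε hε K hK
    have hA : Fintype.card A ≤ Amax := hcard ▸ le_max_left _ _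
    have hB : Fintype.card B ≤ Amax := hcard ▸ le_max_right _ _
    have hmain := DSBR.expectedNashGap_le_div (D := D) hτ hlam0 ht0 hA hB hAmax hR hc0 hc1 hS
      hbal hα hh hD0.le hDinit hDnoise K
    refine hmain.trans (add_le_add_left ?_ _)
    have hK0 : (0 : ℝ) ≤ K := Nat.cast_nonneg K
    rw [div_le_iff₀ hε] at hK
    rw [div_le_iff₀ (by linarith)]
    have := mul_pos hε hh0
    linarith
  · refine ⟨1, one_pos, ?_⟩
    intro A B _ _ _ _ _ _ R hcard hR ε hε K _
    have hA : Fintype.card A ≤ Amax := hcard ▸ le_max_left _ _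
    have hB : Fintype.card B ≤ Amax := hcard ▸ le_max_right _ _
    have hstep' : ∀ k : ℕ, 0 ≤ c * (α / ((k : ℝ) + h)) ∧ c * (α / ((k : ℝ) + h)) ≤ 1 := by
      intro k
      have hk : (0 : ℝ) ≤ k := Nat.cast_nonneg k
      have hn : 0 < (k : ℝ) + h := by linarith
      have h0 : 0 ≤ α / ((k : ℝ) + h) := by positivity
      exact ⟨mul_nonneg hc0.le h0,
        mul_le_one₀ hc1.le h0 ((div_le_one hn).2 (by linarith))⟩
    have hgap := DSBR.expectedNashGap_le_of_forall (R := R) (τ := τ)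
      (α := fun k => α / ((k : ℝ) + h)) (k := K) hstep' fun p₁ hp₁ p₂ hp₂ =>
        DSBR.nashGap_le_of_high_temperature (τ := τ) hA hB
          (fun h2 => not_le.1 fun h3 => hcase ⟨h2, h3⟩) hR hp₁ hp₂
    linarith
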